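/- Let $J\subseteq\mathbb R$ be an open interval and $A\colon J\to\mathbb C\setminus\{0\}$ smooth. Consider the vacuum plane wave spacetime, in Brinkmann coordinates $(\zeta,\bar\zeta,u,v)$ with $\zeta=(x+iy)/\sqrt2\in\mathbb C$, $u\in J$, $v\in\mathbb R$, with metric $$ds^2=-2\,du\,dv-2H\,du^2+2\,d\zeta\,d\bar\zeta,\qquad H=\operatorname{Re}\big(A(u)\zeta^2\big).$$ For a complex null tetrad $(\ell,n,m,\bar m)$ (with $\langle\ell,n\rangle=-1$, $\langle m,\bar m\rangle=1$, all other products zero) let $\Psi_0,\dots,\Psi_4$ be its Newman–Penrose Weyl scalars, $\Psi_4=C_{abcd}\bar m^a n^b\bar m^c n^d$, and for a tetrad field let $\gamma=\tfrac12(n_{a;b}\ell^an^b-\bar m_{a;b}m^an^b)$. A smooth null tetrad field on an open set is canonical if $\Psi_0=\Psi_1=\Psi_2=\Psi_3=0$ and $\Psi_4=1$; the Cartan invariant $\gamma_c$ at a point is the value of $\gamma$ there for a canonical tetrad field defined near the point. The spacetime is called linearly polarized if canonical tetrad fields exist near every point and $\gamma_c$ is real for all of them; it is $+$ (respectively $\times$)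 linearly polarized if moreover $A$ is real-valued (respectively $i$ times real-valued). Let $x(\tau)$, $\tau\in T$ ($T$ a nonempty open interval), be a timelike geodesic parametrized by proper time. Its interpretation tetrad (which is parallel along the geodesic) is $$\ell_i=\tfrac1{\sqrt2\,\dot u}\,\partial_v,\qquad n_i=\sqrt2\,\dot x-\ell_i,\qquad m_i=-\partial_{\bar\zeta}-\tfrac{\dot\zeta}{\dot u}\,\partial_v .$$ Let $\Psi_4(\tau)$ be the Weyl scalar relative to it, and $A_+=\tfrac14(\Psi_4+\bar\Psi_4)$, $A_\times=\tfrac i4(\bar\Psi_4-\Psi_4)$. Suppose that either $A_+$ has no zero along the geodesic and $P=\tfrac12\arctan(A_\times/A_+)\in(-\tfrac\pi4,\tfrac\pi4)$ is constant, or $A_+=0$ along the whole geodesic, in which case $P$ denotes either of $\pm\tfrac\pi4$. Let $U=u(x(T))\subseteq J$. Then: 1. The part $\{u\in U\}$ of the spacetime is linearly polarized (so $\gamma_c$ is real there), with constant phase $2P$: there is a sign $s\in\{1,-1\}$ such that along every timelike geodesic in $\{u\in U\}$, relative to its own interpretation tetrad, $\Psi_4\neq0$ and $\Psi_4=s\,|\Psi_4|\,e^{2iP}$.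 If the geodesic $x$ is inextendible, then $U=J$, so this is the whole spacetime. 2. If $P=0$, the wave is $+$ linearly polarized on $\{u\in U\}$; if $P=\pm\frac\pi4$, it is $\times$ linearly polarized there. 3. These modes are equivalent to each other via spatial rotations. For every $\theta\in\mathbb R$ the rotation $\zeta\mapsto e^{i\theta}\zeta$ (with $u,v$ fixed) is an isometry of $\{u\in U\}$ onto the corresponding part of a plane wave of the same form, with some profile $B$ in place of $A$, which is linearly polarized with constant phase $2(P-\theta)$; for $\theta=P$ it is $+$ polarized and for $\theta=P+\frac\pi4$ it is $\times$ polarized. In particular, if the original wave is $+$ polarized, the rotation by $\frac\pi4$ carries it to a $\times$ polarized one, and if it is $\times$ polarized, to a $+$ polarized one. -/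

import Mathlib

open scoped ContDiff

noncomputable section

namespace PlaneWave

/-! Points and tangent vectors are written in real Brinkmann coordinates `(x, y, u, v)`, indexed by
`0, 1, 2, 3`, with `ζ = (x + i y) / √2`. -/

/-- Partial derivative of a scalar function along the coordinate `i`. -/
def pd (i : Fin 4) (F : (Fin 4 → ℝ) → ℝ) (p : Fin 4 → ℝ) : ℝ :=
  fderiv ℝ F p (Pi.single i 1)

/-- Christoffel symbols `Γ^a_{bc}` of the metric field `g`. -/
def christoffel (g : (Fin 4 → ℝ) → Matrix (Fin 4) (Fin 4) ℝ) (p : Fin 4 → ℝ)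
    (a b c : Fin 4) : ℝ :=
  (1 / 2) * ∑ d, (g p)⁻¹ a d *
    (pd b (fun q => g q d c) p + pd c (fun q => g q d b) p - pd d (fun q => g q b c) p)

/-- Riemann tensor `R^a_{bcd} = ∂_c Γ^a_{bd} - ∂_d Γ^a_{bc} + Γ^a_{ce} Γ^e_{bd} - Γ^a_{de} Γ^e_{bc}`. -/
def riemannUp (g : (Fin 4 → ℝ) → Matrix (Fin 4) (Fin 4) ℝ) (p : Fin 4 → ℝ)
    (a b c d : Fin 4) : ℝ :=
  pd c (fun q => christoffel g q a b d) p - pd d (fun q => christoffel g q a b c) p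
    + ∑ e, (christoffel g p a c e * christoffel g p e b d
        - christoffel g p a d e * christoffel g p e b c)

/-- `R_{abcd} = g_{ae} R^e_{bcd}`. -/
def riemann (g : (Fin 4 → ℝ) → Matrix (Fin 4) (Fin 4) ℝ) (p : Fin 4 → ℝ)
    (a b c d : Fin 4) : ℝ :=
  ∑ e, g p a e * riemannUp g p e b c d

/-- Ricci tensor `R_{bd} = R^a_{bad}`. -/
def ricci (g : (Fin 4 → ℝ) → Matrix (Fin 4) (Fin 4) ℝ) (p : Fin 4 → ℝ) (b d : Fin 4) : ℝ :=
  ∑ a, riemannUp g p a b a d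

/-- Scalar curvature. -/
def scalarCurv (g : (Fin 4 → ℝ) → Matrix (Fin 4) (Fin 4) ℝ) (p : Fin 4 → ℝ) : ℝ :=
  ∑ b, ∑ d, (g p)⁻¹ b d * ricci g p b d

/-- Weyl tensor `C_{abcd}` of a four-dimensional metric. -/
def weyl (g : (Fin 4 → ℝ) → Matrix (Fin 4) (Fin 4) ℝ) (p : Fin 4 → ℝ)
    (a b c d : Fin 4) : ℝ :=
  riemann g p a b c d
    - (1 / 2) * (g p a c * ricci g p b d - g p a d * ricci g p b c
        - g p b c * ricci g p a d + g p b d * ricci g p a c)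
    + (scalarCurv g p / 6) * (g p a c * g p b d - g p a d * g p b c)

/-- A real tangent vector as a complex one. -/
def toC (X : Fin 4 → ℝ) : Fin 4 → ℂ := fun a => (X a : ℂ)

/-- Componentwise complex conjugation of a complex tangent vector. -/
def conjV (X : Fin 4 → ℂ) : Fin 4 → ℂ := fun a => starRingEnd ℂ (X a)

/-- The complex-bilinear extension of the metric at a point. -/
def ip (G : Matrix (Fin 4) (Fin 4) ℝ) (X Y : Fin 4 → ℂ) : ℂ :=
  ∑ a, ∑ b, (G a b : ℂ) * X a * Y b

/-- The complex-multilinear extension of the Weyl tensor, `C(X, Y, Z, W)`. -/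
def weylC (g : (Fin 4 → ℝ) → Matrix (Fin 4) (Fin 4) ℝ) (p : Fin 4 → ℝ)
    (X Y Z W : Fin 4 → ℂ) : ℂ :=
  ∑ a, ∑ b, ∑ c, ∑ d, (weyl g p a b c d : ℂ) * X a * Y b * Z c * W d

/-- Covariant derivative `∇_X Y` at `p` of a complex vector field along a real vector. -/
def covDeriv (g : (Fin 4 → ℝ) → Matrix (Fin 4) (Fin 4) ℝ) (p : Fin 4 → ℝ)
    (X : Fin 4 → ℝ) (Y : (Fin 4 → ℝ) → Fin 4 → ℂ) : Fin 4 → ℂ :=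
  fun a => fderiv ℝ (fun q => Y q a) p X
    + ∑ b, ∑ c, (christoffel g p a b c : ℂ) * (X b : ℂ) * Y p c

/-- A tetrad `(ℓ, n, m, m̄)` at a point: `ℓ`, `n` real, `m` complex, `m̄` the conjugate of `m`. -/
structure Tetrad where
  l : Fin 4 → ℝ
  n : Fin 4 → ℝ
  m : Fin 4 → ℂ

/-- The vector `m̄` of a tetrad. -/
def Tetrad.mbar (E : Tetrad) : Fin 4 → ℂ := conjV E.m

/-- `E` is a complex null tetrad: the only non-zero products are `⟨ℓ, n⟩ = -1`, `⟨m, m̄⟩ = 1`. -/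
structure Tetrad.IsNull (E : Tetrad) (G : Matrix (Fin 4) (Fin 4) ℝ) : Prop where
  ll : ip G (toC E.l) (toC E.l) = 0
  nn : ip G (toC E.n) (toC E.n) = 0
  mm : ip G E.m E.m = 0
  lm : ip G (toC E.l) E.m = 0
  nm : ip G (toC E.n) E.m = 0
  ln : ip G (toC E.l) (toC E.n) = -1
  mmbar : ip G E.m E.mbar = 1

/-- Newman-Penrose Weyl scalars `Ψ₀, …, Ψ₄` relative to a null tetrad. -/
def Psi0 (g : (Fin 4 → ℝ) → Matrix (Fin 4) (Fin 4) ℝ) (p : Fin 4 → ℝ) (E : Tetrad) : ℂ :=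
  weylC g p (toC E.l) E.m (toC E.l) E.m

def Psi1 (g : (Fin 4 → ℝ) → Matrix (Fin 4) (Fin 4) ℝ) (p : Fin 4 → ℝ) (E : Tetrad) : ℂ :=
  weylC g p (toC E.l) (toC E.n) (toC E.l) E.m

def Psi2 (g : (Fin 4 → ℝ) → Matrix (Fin 4) (Fin 4) ℝ) (p : Fin 4 → ℝ) (E : Tetrad) : ℂ :=
  weylC g p (toC E.l) E.m E.mbar (toC E.n)

def Psi3 (g : (Fin 4 → ℝ) → Matrix (Fin 4) (Fin 4) ℝ) (p : Fin 4 → ℝ) (E : Tetrad) : ℂ :=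
  weylC g p (toC E.l) (toC E.n) E.mbar (toC E.n)

def Psi4 (g : (Fin 4 → ℝ) → Matrix (Fin 4) (Fin 4) ℝ) (p : Fin 4 → ℝ) (E : Tetrad) : ℂ :=
  weylC g p E.mbar (toC E.n) E.mbar (toC E.n)

/-- The Newman-Penrose spin coefficient
`γ = ½ (n_{a;b} ℓ^a n^b - m̄_{a;b} m^a n^b)` of a tetrad field. -/
def spinGamma (g : (Fin 4 → ℝ) → Matrix (Fin 4) (Fin 4) ℝ) (E : (Fin 4 → ℝ) → Tetrad)
    (p : Fin 4 → ℝ) : ℂ :=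
  (1 / 2) * (ip (g p) (covDeriv g p (E p).n (fun q => toC (E q).n)) (toC (E p).l)
    - ip (g p) (covDeriv g p (E p).n (fun q => (E q).mbar)) (E p).m)

/-- `E` is a canonical tetrad field on `W`: a smooth null tetrad field whose only non-vanishing
Weyl scalar is `Ψ₄`, normalized to `Ψ₄ = 1`. -/
structure IsCanonical (g : (Fin 4 → ℝ) → Matrix (Fin 4) (Fin 4) ℝ) (W : Set (Fin 4 → ℝ))
    (E : (Fin 4 → ℝ) → Tetrad) : Prop where
  smooth_l : ContDiffOn ℝ ∞ (fun q => (E q).l) W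
  smooth_n : ContDiffOn ℝ ∞ (fun q => (E q).n) W
  smooth_m : ContDiffOn ℝ ∞ (fun q => (E q).m) W
  null : ∀ p ∈ W, (E p).IsNull (g p)
  psi0 : ∀ p ∈ W, Psi0 g p (E p) = 0
  psi1 : ∀ p ∈ W, Psi1 g p (E p) = 0
  psi2 : ∀ p ∈ W, Psi2 g p (E p) = 0
  psi3 : ∀ p ∈ W, Psi3 g p (E p) = 0
  psi4 : ∀ p ∈ W, Psi4 g p (E p) = 1

/-- `c` is a value at `p` of the Cartan invariant `γ_c`: the spin coefficient `γ` of some canonical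
tetrad field defined near `p`. -/
def IsCartanGamma (g : (Fin 4 → ℝ) → Matrix (Fin 4) (Fin 4) ℝ) (p : Fin 4 → ℝ) (c : ℂ) : Prop :=
  ∃ (W : Set (Fin 4 → ℝ)) (E : (Fin 4 → ℝ) → Tetrad),
    IsOpen W ∧ p ∈ W ∧ IsCanonical g W E ∧ c = spinGamma g E p

/-- The complex coordinate `ζ = (x + i y) / √2`, also applied to tangent vectors. -/
def zeta (p : Fin 4 → ℝ) : ℂ := ((p 0 : ℂ) + Complex.I * (p 1 : ℂ)) / ((Real.sqrt 2 : ℝ) : ℂ)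

/-- `H = Re f`, with `f(ζ, u) = A(u) ζ²`. -/
def profileH (A : ℝ → ℂ) (p : Fin 4 → ℝ) : ℝ := (A (p 2) * zeta p ^ 2).re

/-- The vacuum plane wave metric `-2 du dv - 2 H du² + 2 dζ dζ̄`, where `2 dζ dζ̄ = dx² + dy²`. -/
def metric (A : ℝ → ℂ) (p : Fin 4 → ℝ) : Matrix (Fin 4) (Fin 4) ℝ :=
  !![1, 0, 0, 0;
     0, 1, 0, 0;
     0, 0, -2 * profileH A p, -1;
     0, 0, -1, 0]

/-- On the part `u ∈ U` of the plane wave with profile `A`, the Cartan invariant `γ_c` exists at every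
point and is real-valued. -/
def IsLinearlyPolarized (A : ℝ → ℂ) (U : Set ℝ) : Prop :=
  ∀ p : Fin 4 → ℝ, p 2 ∈ U →
    (∃ c, IsCartanGamma (metric A) p c) ∧ ∀ c, IsCartanGamma (metric A) p c → c.im = 0

/-- `+` linear polarization: linearly polarized with real profile `A`. -/
def IsPlusPolarized (A : ℝ → ℂ) (U : Set ℝ) : Prop :=
  IsLinearlyPolarized A U ∧ ∀ u ∈ U, (A u).im = 0

/-- `×` linear polarization: linearly polarized with `A` equal to `i` times a real profile. -/
def IsCrossPolarized (A : ℝ → ℂ) (U : Set ℝ) : Prop :=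
  IsLinearlyPolarized A U ∧ ∀ u ∈ U, (A u).re = 0

/-- `x` restricted to the open interval `T` is a timelike geodesic, parametrized by proper time, of the
plane wave with profile `A` over `u ∈ U`. -/
structure IsTimelikeGeodesic (A : ℝ → ℂ) (U : Set ℝ) (T : Set ℝ) (x : ℝ → Fin 4 → ℝ) :
    Prop where
  isOpen : IsOpen T
  ordConnected : T.OrdConnected
  nonempty : T.Nonempty
  contDiffOn : ContDiffOn ℝ 2 x T
  mem : ∀ τ ∈ T, x τ 2 ∈ U
  timelike : ∀ τ ∈ T, ∑ a, ∑ b, metric A (x τ) a b * deriv x τ a * deriv x τ b = -1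
  geodesic : ∀ τ ∈ T, ∀ a, deriv (deriv x) τ a
    + ∑ b, ∑ c, christoffel (metric A) (x τ) a b c * deriv x τ b * deriv x τ c = 0

/-- The geodesic `x` on `T` cannot be continued as a geodesic of the spacetime to a larger interval. -/
def IsInextendible (A : ℝ → ℂ) (U : Set ℝ) (T : Set ℝ) (x : ℝ → Fin 4 → ℝ) : Prop :=
  ∀ (T' : Set ℝ) (y : ℝ → Fin 4 → ℝ),
    T ⊆ T' → IsTimelikeGeodesic A U T' y → Set.EqOn y x T → T' = T

/-- The interpretation tetrad tied to a four-velocity `X = ẋ`: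
`ℓ = (1 / (√2 u̇)) ∂_v`, `n = √2 ẋ - ℓ`, `m = -∂_ζ̄ - (ζ̇ / u̇) ∂_v`,
where `∂_ζ̄ = (∂_x + i ∂_y) / √2`. -/
def interpTetrad (X : Fin 4 → ℝ) : Tetrad where
  l := ![0, 0, 0, 1 / (Real.sqrt 2 * X 2)]
  n := ![Real.sqrt 2 * X 0, Real.sqrt 2 * X 1, Real.sqrt 2 * X 2,
    Real.sqrt 2 * X 3 - 1 / (Real.sqrt 2 * X 2)]
  m := ![-1 / ((Real.sqrt 2 : ℝ) : ℂ), -Complex.I / ((Real.sqrt 2 : ℝ) : ℂ), 0,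
    -(zeta X / (X 2 : ℂ))]

/-- `Ψ₄` along the curve `x`, relative to the interpretation tetrad. -/
def psi4Along (A : ℝ → ℂ) (x : ℝ → Fin 4 → ℝ) (τ : ℝ) : ℂ :=
  Psi4 (metric A) (x τ) (interpTetrad (deriv x τ))

/-- `A₊ = ¼ (Ψ₄ + Ψ̄₄)`, a real number. -/
def aPlus (Ψ : ℂ) : ℝ := ((1 / 4) * (Ψ + starRingEnd ℂ Ψ)).re

/-- `A_× = (i/4) (Ψ̄₄ - Ψ₄)`, a real number. -/
def aCross (Ψ : ℂ) : ℝ := ((Complex.I / 4) * (starRingEnd ℂ Ψ - Ψ)).re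

/-- The constant `P` is the phase of `Ψ₄` along `x` on `T`: either `A₊` has no zero and
`P = ½ arctan (A_× / A₊)` throughout, or `A₊` vanishes identically and `P = ± π/4`. -/
def HasPhase (A : ℝ → ℂ) (T : Set ℝ) (x : ℝ → Fin 4 → ℝ) (P : ℝ) : Prop :=
  (∀ τ ∈ T, aPlus (psi4Along A x τ) ≠ 0 ∧
      P = (1 / 2) * Real.arctan (aCross (psi4Along A x τ) / aPlus (psi4Along A x τ)))
  ∨ ((∀ τ ∈ T, aPlus (psi4Along A x τ) = 0) ∧ (P = Real.pi / 4 ∨ P = -(Real.pi / 4)))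

/-- On the part `u ∈ U` of the plane wave, `Ψ₄` has the constant phase `φ` (an angle modulo `π`, that is,
up to one overall sign `s`) along all timelike geodesics, relative to their interpretation tetrads. -/
def HasConstantPhase (A : ℝ → ℂ) (U : Set ℝ) (φ : ℝ) : Prop :=
  ∃ s : ℝ, (s = 1 ∨ s = -1) ∧ ∀ (T : Set ℝ) (y : ℝ → Fin 4 → ℝ),
    IsTimelikeGeodesic A U T y → ∀ τ ∈ T, psi4Along A y τ ≠ 0 ∧
      psi4Along A y τ = (s : ℂ) * (‖psi4Along A y τ‖ : ℂ) * Complex.exp (Complex.I * (φ : ℂ))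

/-- The spatial rotation `ζ ↦ e^{iθ} ζ` fixing `u` and `v`; being linear, it is its own
differential. -/
def rot (θ : ℝ) (p : Fin 4 → ℝ) : Fin 4 → ℝ :=
  ![Real.cos θ * p 0 - Real.sin θ * p 1, Real.sin θ * p 0 + Real.cos θ * p 1, p 2, p 3]

/-- Over `u ∈ U`, the rotation by `θ` is an isometry from the plane wave with profile `A` to the one
with profile `B`. -/
def RotationEquivalent (θ : ℝ) (A B : ℝ → ℂ) (U : Set ℝ) : Prop :=
  ∀ p : Fin 4 → ℝ, p 2 ∈ U → ∀ X Y : Fin 4 → ℝ,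
    ∑ a, ∑ b, metric B (rot θ p) a b * rot θ X a * rot θ Y b
      = ∑ a, ∑ b, metric A p a b * X a * Y b

end PlaneWave

end

open scoped ContDiff

noncomputable section

/-! ### Coordinate form of the profile function `H` and its derivatives. -/

namespace PlaneWave

/-! Everything follows from one formula for the curvature. The metric is flat up to the term `-2 H
du²`, with `H` harmonic in the transverse plane, so the Weyl tensor is `½ (A Z ⊗ Z + Ā Z̄ ⊗ Z̄)`
with `Z = (dx + i dy) ∧ du` (`weylC_metric`). Hence `Ψ₄ = 2 u̇² A(u)` in an interpretation tetrad.
Along a timelike geodesic `u` is affine with non-zero slope, so the phase hypothesis says exactly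
that `A` is a real multiple of `e^{2iP}` on the open interval `U`. As `A` is continuous and has no
zero, the sign of the multiple is constant; this is `ProfilePhase`, and it gives the constant phase
along every other timelike geodesic.

Reality of `γ_c`: `Ψ₀ = 0` forces `ℓ` to be parallel to `∂_v`, and then `Ψ₄ = 1` fixes the square of
the transverse part of `m̄` up to finitely many values that depend only on the constant phase of
`A`. By continuity this part is locally constant, so `⟨∇_n m̄, m⟩ = 0` and `γ = ½ ⟨∇_n n, ℓ⟩` is
real (`IsCanonical.spinGamma_im`). A boost by `|A|^{-1/2}` gives a canonical tetrad
(`exists_isCanonical`).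

Inextendible geodesics reach all of `J` because the transverse geodesic equation is linear: its
solutions exist on intervals independent of the initial values, and `v` follows from the
normalization by integration (`IsTimelikeGeodesic.exists_extension`). Rotation by `θ` multiplies `A`
by `e^{-2iθ}`, which gives the statements on equivalence of the modes. -/

lemma profileH_eq (A : ℝ → ℂ) (p : Fin 4 → ℝ) :
    profileH A p = (A (p 2)).re * (p 0 ^ 2 - p 1 ^ 2) / 2 - (A (p 2)).im * (p 0 * p 1) := by
  have h2 : ((Real.sqrt 2 : ℝ) : ℂ) ^ 2 = 2 := by
    rw [← Complex.ofReal_pow, Real.sq_sqrt (by norm_num)]; norm_num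
  have : zeta p ^ 2
      = (((p 0 ^ 2 - p 1 ^ 2) / 2 : ℝ) : ℂ) + ((p 0 * p 1 : ℝ) : ℂ) * Complex.I := by
    unfold zeta
    rw [div_pow, h2]
    push_cast
    linear_combination ((p 1 : ℂ) ^ 2 / 2) * Complex.I_sq
  unfold profileH
  rw [this]
  rw [Complex.mul_re, Complex.add_re, Complex.add_im, Complex.re_ofReal_mul, Complex.im_ofReal_mul,
    Complex.ofReal_re, Complex.ofReal_im, Complex.I_re, Complex.I_im]
  ring

/-- The function `a(u) (x² - y²) / 2 - b(u) x y`. -/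
def quad (a b : ℝ → ℝ) (p : Fin 4 → ℝ) : ℝ :=
  a (p 2) * (p 0 ^ 2 - p 1 ^ 2) / 2 - b (p 2) * (p 0 * p 1)

/-- The function `a(u) pᵢ - b(u) pⱼ`. -/
def lin (a b : ℝ → ℝ) (i j : Fin 4) (p : Fin 4 → ℝ) : ℝ :=
  a (p 2) * p i - b (p 2) * p j

lemma hasFDerivAt_coord (i : Fin 4) (p : Fin 4 → ℝ) :
    HasFDerivAt (fun q : Fin 4 → ℝ => q i) (ContinuousLinearMap.proj (R := ℝ) i) p :=
  hasFDerivAt_apply i p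

lemma hasFDerivAt_comp_u {a : ℝ → ℝ} {p : Fin 4 → ℝ} (ha : DifferentiableAt ℝ a (p 2)) :
    HasFDerivAt (fun q : Fin 4 → ℝ => a (q 2))
      (deriv a (p 2) • ContinuousLinearMap.proj (R := ℝ) (φ := fun _ : Fin 4 => ℝ) 2) p :=
  ha.hasDerivAt.comp_hasFDerivAt p (hasFDerivAt_coord 2 p)

lemma hasFDerivAt_quad {a b : ℝ → ℝ} {p : Fin 4 → ℝ} (ha : DifferentiableAt ℝ a (p 2))
    (hb : DifferentiableAt ℝ b (p 2)) :
    ∃ D : (Fin 4 → ℝ) →L[ℝ] ℝ, HasFDerivAt (quad a b) D p ∧ ∀ X, D X =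
      (a (p 2) * p 0 - b (p 2) * p 1) * X 0 + (-a (p 2) * p 1 - b (p 2) * p 0) * X 1
        + quad (deriv a) (deriv b) p * X 2 := by
  have h := ((((hasFDerivAt_comp_u ha).mul (((hasFDerivAt_coord 0 p).pow 2).sub
    ((hasFDerivAt_coord 1 p).pow 2))).mul_const (1 / 2))).sub
      ((hasFDerivAt_comp_u hb).mul ((hasFDerivAt_coord 0 p).mul (hasFDerivAt_coord 1 p)))
  refine ⟨_, h.congr_of_eventuallyEq (.of_forall fun q => ?_), fun X => ?_⟩
  · simp [quad]; ring
  · simp [quad]; ring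

lemma hasFDerivAt_lin {a b : ℝ → ℝ} {p : Fin 4 → ℝ} (ha : DifferentiableAt ℝ a (p 2))
    (hb : DifferentiableAt ℝ b (p 2)) (i j : Fin 4) :
    ∃ D : (Fin 4 → ℝ) →L[ℝ] ℝ, HasFDerivAt (lin a b i j) D p ∧ ∀ X, D X =
      a (p 2) * X i - b (p 2) * X j + lin (deriv a) (deriv b) i j p * X 2 := by
  have h := ((hasFDerivAt_comp_u ha).mul (hasFDerivAt_coord i p)).sub
      ((hasFDerivAt_comp_u hb).mul (hasFDerivAt_coord j p))
  refine ⟨_, h, fun X => ?_⟩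
  simp [lin]; ring

/-- Real part of the profile. -/
def reA (A : ℝ → ℂ) (u : ℝ) : ℝ := (A u).re
/-- Imaginary part of the profile. -/
def imA (A : ℝ → ℂ) (u : ℝ) : ℝ := (A u).im

lemma profileH_eq_quad (A : ℝ → ℂ) : profileH A = quad (reA A) (imA A) :=
  funext fun p => profileH_eq A p

/-- The components `∂_x H`, `∂_y H`, `∂_u H`, `∂_v H`. -/
def gradH (A : ℝ → ℂ) (p : Fin 4 → ℝ) : Fin 4 → ℝ :=
  ![lin (reA A) (imA A) 0 1 p, lin (-reA A) (imA A) 1 0 p,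
    quad (deriv (reA A)) (deriv (imA A)) p, 0]

/-! ### Derivatives of the metric, Christoffel symbols and the Hessian of `H`. -/

section Smooth
variable {A : ℝ → ℂ} {U : Set ℝ}

lemma contDiffOn_reA (hA : ContDiffOn ℝ ∞ A U) : ContDiffOn ℝ ∞ (reA A) U :=
  Complex.reCLM.contDiff.comp_contDiffOn hA

lemma contDiffOn_imA (hA : ContDiffOn ℝ ∞ A U) : ContDiffOn ℝ ∞ (imA A) U :=
  Complex.imCLM.contDiff.comp_contDiffOn hA

lemma _root_.ContDiffOn.differentiableAt_of_isOpen {f : ℝ → ℝ} (hU : IsOpen U)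
    (hf : ContDiffOn ℝ ∞ f U) {u : ℝ} (hu : u ∈ U) : DifferentiableAt ℝ f u :=
  (hf.contDiffAt (hU.mem_nhds hu)).differentiableAt (by simp)

lemma _root_.ContDiffOn.differentiableAt_deriv_of_isOpen {f : ℝ → ℝ} (hU : IsOpen U)
    (hf : ContDiffOn ℝ ∞ f U) {u : ℝ} (hu : u ∈ U) : DifferentiableAt ℝ (deriv f) u :=
  (hf.deriv_of_isOpen (m := ∞) hU (by simp)).differentiableAt_of_isOpen hU hu

lemma pd_of_hasFDerivAt {F : (Fin 4 → ℝ) → ℝ} {p : Fin 4 → ℝ} {D : (Fin 4 → ℝ) →L[ℝ] ℝ}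
    (h : HasFDerivAt F D p) (i : Fin 4) : pd i F p = D (Pi.single i 1) := by
  rw [pd, h.fderiv]

lemma pd_profileH (hU : IsOpen U) (hA : ContDiffOn ℝ ∞ A U) {p : Fin 4 → ℝ} (hp : p 2 ∈ U)
    (i : Fin 4) : pd i (profileH A) p = gradH A p i := by
  obtain ⟨D, hD, hX⟩ := hasFDerivAt_quad
    ((contDiffOn_reA hA).differentiableAt_of_isOpen hU hp)
    ((contDiffOn_imA hA).differentiableAt_of_isOpen hU hp)
  rw [profileH_eq_quad, pd_of_hasFDerivAt hD, hX]
  fin_cases i <;> simp [gradH, lin]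

/-- The covector `du`. -/
def du : Fin 4 → ℝ := ![0, 0, 1, 0]

/-- The vector `∂_v`. -/
def ev : Fin 4 → ℝ := ![0, 0, 0, 1]

/-- The gradient of `H` in the transverse directions. -/
def tgradH (A : ℝ → ℂ) (p : Fin 4 → ℝ) : Fin 4 → ℝ := ![gradH A p 0, gradH A p 1, 0, 0]

lemma metric_inv (A : ℝ → ℂ) (p : Fin 4 → ℝ) : (metric A p)⁻¹ =
    !![1, 0, 0, 0; 0, 1, 0, 0; 0, 0, 0, -1; 0, 0, -1, 2 * profileH A p] := by
  apply Matrix.inv_eq_right_inv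
  ext i j
  fin_cases i <;> fin_cases j <;> simp [metric, Matrix.mul_apply, Fin.sum_univ_four]

lemma pd_metric (hU : IsOpen U) (hA : ContDiffOn ℝ ∞ A U) {p : Fin 4 → ℝ} (hp : p 2 ∈ U)
    (i a b : Fin 4) :
    pd i (fun q => metric A q a b) p = -2 * gradH A p i * du a * du b := by
  have h : (fun q => metric A q a b)
      = fun q => -2 * du a * du b * profileH A q + metric 0 0 a b := by
    funext q
    fin_cases a <;> fin_cases b <;> simp [metric, du, profileH]
  have hd : DifferentiableAt ℝ (profileH A) p := by
    obtain ⟨D, hD, -⟩ := hasFDerivAt_quad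
      ((contDiffOn_reA hA).differentiableAt_of_isOpen hU hp)
      ((contDiffOn_imA hA).differentiableAt_of_isOpen hU hp)
    rw [profileH_eq_quad]
    exact hD.differentiableAt
  rw [h, pd, fderiv_add_const, fderiv_const_mul hd]
  change -2 * du a * du b * pd i (profileH A) p = _
  rw [pd_profileH hU hA hp]
  ring

lemma christoffel_metric (hU : IsOpen U) (hA : ContDiffOn ℝ ∞ A U) {p : Fin 4 → ℝ}
    (hp : p 2 ∈ U) (a b c : Fin 4) : christoffel (metric A) p a b c =
      ev a * (gradH A p b * du c + du b * gradH A p c - gradH A p 2 * du b * du c)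
        + tgradH A p a * (du b * du c) := by
  have h3 : gradH A p 3 = 0 := rfl
  unfold christoffel
  simp only [pd_metric hU hA hp, metric_inv]
  fin_cases a <;> simp [Fin.sum_univ_four, du, ev, tgradH, h3] <;> ring

/-- The transverse Hessian of `H`. -/
def hessH (A : ℝ → ℂ) (u : ℝ) : Matrix (Fin 4) (Fin 4) ℝ :=
  !![(A u).re, -(A u).im, 0, 0; -(A u).im, -(A u).re, 0, 0; 0, 0, 0, 0; 0, 0, 0, 0]

/-- The `u`-derivative of the transverse gradient of `H`. -/
def tgradHu (A : ℝ → ℂ) (p : Fin 4 → ℝ) : Fin 4 → ℝ :=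
  ![lin (deriv (reA A)) (deriv (imA A)) 0 1 p, lin (deriv (-reA A)) (deriv (imA A)) 1 0 p, 0, 0]

/-- The entry `∂_u² H` is left out because it contains second derivatives of `A` and never reaches
the curvature. -/
lemma hasFDerivAt_gradH (hU : IsOpen U) (hA : ContDiffOn ℝ ∞ A U) {p : Fin 4 → ℝ}
    (hp : p 2 ∈ U) (a : Fin 4) : DifferentiableAt ℝ (fun q => gradH A q a) p ∧ ∀ i,
      ¬ (i = 2 ∧ a = 2) → pd i (fun q => gradH A q a) p
        = hessH A (p 2) i a + tgradHu A p i * du a + tgradHu A p a * du i := by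
  have ha := contDiffOn_reA hA
  have hb := contDiffOn_imA hA
  have hda := ha.differentiableAt_of_isOpen hU hp
  have hdb := hb.differentiableAt_of_isOpen hU hp
  fin_cases a
  · obtain ⟨D, hD, hX⟩ := hasFDerivAt_lin hda hdb 0 1
    refine ⟨hD.differentiableAt, fun i hi => ?_⟩
    change pd i (lin (reA A) (imA A) 0 1) p = _
    rw [pd_of_hasFDerivAt hD, hX]
    fin_cases i <;> simp [hessH, du, tgradHu, reA, imA]
  · obtain ⟨D, hD, hX⟩ := hasFDerivAt_lin hda.neg hdb 1 0
    refine ⟨hD.differentiableAt, fun i hi => ?_⟩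
    change pd i (lin (-reA A) (imA A) 1 0) p = _
    rw [pd_of_hasFDerivAt hD, hX]
    fin_cases i <;> simp [hessH, du, tgradHu, reA, imA]
  · obtain ⟨D, hD, hX⟩ := hasFDerivAt_quad (ha.differentiableAt_deriv_of_isOpen hU hp)
      (hb.differentiableAt_deriv_of_isOpen hU hp)
    refine ⟨hD.differentiableAt, fun i hi => ?_⟩
    change pd i (quad (deriv (reA A)) (deriv (imA A))) p = _
    rw [pd_of_hasFDerivAt hD, hX]
    fin_cases i <;> simp [hessH, du, tgradHu, lin] at hi ⊢
  · refine ⟨differentiableAt_const _, fun i hi => ?_⟩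
    change pd i (fun _ => 0) p = _
    fin_cases i <;> simp [hessH, du, tgradHu, pd]

end Smooth

/-! ### Riemann, Ricci and Weyl tensors. -/

section Curvature
variable {A : ℝ → ℂ} {U : Set ℝ}

lemma hessH_two (u : ℝ) (c : Fin 4) : hessH A u c 2 = 0 := by
  fin_cases c <;> rfl

lemma hessH_three (u : ℝ) (c : Fin 4) : hessH A u c 3 = 0 := by
  fin_cases c <;> rfl

lemma hessH_symm (u : ℝ) (c d : Fin 4) : hessH A u c d = hessH A u d c := by
  fin_cases c <;> fin_cases d <;> rfl

/-- The projection to transverse components. -/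
def transv : Fin 4 → ℝ := ![1, 1, 0, 0]

lemma tgradH_eq (p : Fin 4 → ℝ) (a : Fin 4) : tgradH A p a = transv a * gradH A p a := by
  fin_cases a <;> simp [tgradH, transv]

/-- The unknown `K` stands for `∂_u² H`. It multiplies `du ⊗ du` only and cancels when the Riemann
tensor is antisymmetrized. -/
lemma pd_gradH (hU : IsOpen U) (hA : ContDiffOn ℝ ∞ A U) {p : Fin 4 → ℝ} (hp : p 2 ∈ U) :
    ∃ K, ∀ i a, pd i (fun q => gradH A q a) p
      = hessH A (p 2) i a + tgradHu A p i * du a + tgradHu A p a * du i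
        + K * (du i * du a) := by
  refine ⟨pd 2 (fun q => gradH A q 2) p, fun i a => ?_⟩
  by_cases h : i = 2 ∧ a = 2
  · obtain ⟨rfl, rfl⟩ := h
    simp [hessH_two, tgradHu, du]
  · rw [(hasFDerivAt_gradH hU hA hp a).2 i h]
    have : du i * du a = 0 := by
      fin_cases i <;> fin_cases a <;> simp [du] at h ⊢
    rw [this]; ring

lemma pd_christoffel (hU : IsOpen U) (hA : ContDiffOn ℝ ∞ A U) {p : Fin 4 → ℝ} (hp : p 2 ∈ U)
    (i a b c : Fin 4) : pd i (fun q => christoffel (metric A) q a b c) p =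
      ev a * (pd i (fun q => gradH A q b) p * du c + du b * pd i (fun q => gradH A q c) p
          - pd i (fun q => gradH A q 2) p * (du b * du c))
        + transv a * pd i (fun q => gradH A q a) p * (du b * du c) := by
  have hev : (fun q => christoffel (metric A) q a b c) =ᶠ[nhds p] fun q =>
      ev a * (gradH A q b * du c + du b * gradH A q c - gradH A q 2 * (du b * du c))
        + transv a * gradH A q a * (du b * du c) := by
    have : ∀ᶠ q : Fin 4 → ℝ in nhds p, q 2 ∈ U :=
      (continuous_apply 2).continuousAt.eventually (hU.mem_nhds hp)
    filter_upwards [this] with q hq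
    rw [christoffel_metric hU hA hq, tgradH_eq]; ring
  have hd := fun a => (hasFDerivAt_gradH hU hA hp a).1.hasFDerivAt
  have h := ((((hd b).mul_const (du c)).add ((hd c).const_mul (du b))).sub
    ((hd 2).mul_const (du b * du c))).const_mul (ev a) |>.add
      (((hd a).const_mul (transv a)).mul_const (du b * du c))
  rw [pd, hev.fderiv_eq]
  erw [h.fderiv]
  simp [pd]
  ring

/-- The products `Γ Γ` survive only as `|∇H|²` (transverse gradient) times `∂_v` and three factors
`du`, symmetric in `c, d`, so they cancel; what remains is linear in the Hessian. -/
lemma riemannUp_metric (hU : IsOpen U) (hA : ContDiffOn ℝ ∞ A U) {p : Fin 4 → ℝ} (hp : p 2 ∈ U)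
    (a b c d : Fin 4) : riemannUp (metric A) p a b c d =
      (hessH A (p 2) c a * du d - hessH A (p 2) d a * du c) * du b
        + ev a * (hessH A (p 2) c b * du d - hessH A (p 2) d b * du c) := by
  unfold riemannUp
  obtain ⟨K, hK⟩ := pd_gradH hU hA hp
  simp only [pd_christoffel hU hA hp, christoffel_metric hU hA hp, hK]
  rw [hessH_symm (p 2) d c]
  have h3 : gradH A p 3 = 0 := rfl
  have h2 : tgradHu A p 2 = 0 := rfl
  fin_cases a <;>
    simp [Fin.sum_univ_four, ev, transv, hessH_two, hessH_three, h3, h2, tgradH,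
      show du 0 = 0 from rfl, show du 1 = 0 from rfl, show du 2 = 1 from rfl,
      show du 3 = 0 from rfl] <;> ring

/-- The only possible component is the trace of the transverse Hessian, and `H` is harmonic there.
-/
lemma ricci_metric (hU : IsOpen U) (hA : ContDiffOn ℝ ∞ A U) {p : Fin 4 → ℝ} (hp : p 2 ∈ U)
    (b d : Fin 4) : ricci (metric A) p b d = 0 := by
  unfold ricci
  simp only [riemannUp_metric hU hA hp]
  fin_cases b <;> fin_cases d <;> simp [Fin.sum_univ_four, ev, du, hessH]

lemma weyl_metric (hU : IsOpen U) (hA : ContDiffOn ℝ ∞ A U) {p : Fin 4 → ℝ} (hp : p 2 ∈ U)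
    (a b c d : Fin 4) : weyl (metric A) p a b c d =
      (hessH A (p 2) c a * du d - hessH A (p 2) d a * du c) * du b
        - (hessH A (p 2) c b * du d - hessH A (p 2) d b * du c) * du a := by
  unfold weyl scalarCurv riemann
  simp only [ricci_metric hU hA hp, riemannUp_metric hU hA hp]
  fin_cases a <;> simp [Fin.sum_univ_four, metric, ev, hessH_two, hessH_three, du]

/-- The two-form `(dx + i dy) ∧ du`. -/
def zform (X Y : Fin 4 → ℂ) : ℂ :=
  (X 0 + Complex.I * X 1) * Y 2 - X 2 * (Y 0 + Complex.I * Y 1)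

/-- The two-form `(dx - i dy) ∧ du`. -/
def zbform (X Y : Fin 4 → ℂ) : ℂ :=
  (X 0 - Complex.I * X 1) * Y 2 - X 2 * (Y 0 - Complex.I * Y 1)

/-- The transverse Hessian of `H` is `Re (A (dx + i dy)²)`, so the curvature is the real part of `A`
times the square of a single complex two-form. -/
lemma weylC_metric (hU : IsOpen U) (hA : ContDiffOn ℝ ∞ A U) {p : Fin 4 → ℝ} (hp : p 2 ∈ U)
    (X Y Z W : Fin 4 → ℂ) : weylC (metric A) p X Y Z W =
      (1 / 2) * (A (p 2) * zform X Y * zform Z W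
        + starRingEnd ℂ (A (p 2)) * zbform X Y * zbform Z W) := by
  unfold weylC
  simp only [weyl_metric hU hA hp]
  have e1 : A (p 2) = (A (p 2)).re + (A (p 2)).im * Complex.I := (Complex.re_add_im _).symm
  have e2 : starRingEnd ℂ (A (p 2)) = (A (p 2)).re - (A (p 2)).im * Complex.I := by
    apply Complex.ext <;> simp
  rw [e2, show A (p 2) * zform X Y = ((A (p 2)).re + (A (p 2)).im * Complex.I) * zform X Y by
    rw [← e1]]
  simp [Fin.sum_univ_four, hessH, du, zform, zbform, -Complex.re_add_im]
  generalize ((A (p 2)).re : ℂ) = a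
  generalize ((A (p 2)).im : ℂ) = b
  ring_nf
  simp only [Complex.I_sq]
  ring

end Curvature

/-! ### Null tetrads and their Weyl scalars. -/

section Tetrads
variable {A : ℝ → ℂ} {U : Set ℝ}

lemma ip_metric (A : ℝ → ℂ) (p : Fin 4 → ℝ) (X Y : Fin 4 → ℂ) :
    ip (metric A p) X Y = X 0 * Y 0 + X 1 * Y 1 - 2 * (profileH A p : ℂ) * X 2 * Y 2
      - X 2 * Y 3 - X 3 * Y 2 := by
  simp [ip, metric, Fin.sum_univ_four]
  ring

/-- The form `dx - i dy` annihilates `m̄`, so the `Ā` half of the Weyl tensor drops out, while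
`zform` takes the value `-2 u̇` on `(m̄, n)`. -/
lemma Psi4_interpTetrad (hU : IsOpen U) (hA : ContDiffOn ℝ ∞ A U) {p : Fin 4 → ℝ}
    (hp : p 2 ∈ U) (X : Fin 4 → ℝ) :
    Psi4 (metric A) p (interpTetrad X) = ((2 * X 2 ^ 2 : ℝ) : ℂ) * A (p 2) := by
  have h2 : ((Real.sqrt 2 : ℝ) : ℂ) ^ 2 = 2 := by
    rw [← Complex.ofReal_pow, Real.sq_sqrt (by norm_num)]; norm_num
  have h0 : ((Real.sqrt 2 : ℝ) : ℂ) ≠ 0 := by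
    intro h; rw [h] at h2; norm_num at h2
  rw [Psi4, weylC_metric hU hA hp]
  simp [zform, zbform, Tetrad.mbar, conjV, toC, interpTetrad]
  field_simp
  ring_nf
  simp only [Complex.I_sq, show Complex.I ^ 4 = 1 from Complex.I_pow_four]
  ring

/-- A null vector of the complexified plane lies on one of two isotropic lines, on which both
components have equal modulus. -/
lemma transverse_null {m₀ m₁ : ℂ} (h : m₀ ^ 2 + m₁ ^ 2 = 0)
    (h1 : m₀ * starRingEnd ℂ m₀ + m₁ * starRingEnd ℂ m₁ = 1) :
    (m₁ = Complex.I * m₀ ∨ m₁ = -(Complex.I * m₀)) ∧ ‖m₀‖ ^ 2 = 1 / 2 := by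
  have hs : m₁ = Complex.I * m₀ ∨ m₁ = -(Complex.I * m₀) := by
    apply sq_eq_sq_iff_eq_or_eq_neg.1
    linear_combination h - m₀ ^ 2 * Complex.I_sq
  refine ⟨hs, ?_⟩
  have hn : ‖m₁‖ = ‖m₀‖ := by rcases hs with rfl | rfl <;> simp
  rw [Complex.mul_conj', Complex.mul_conj', hn] at h1
  have : ‖m₀‖ ^ 2 + ‖m₀‖ ^ 2 = 1 := by exact_mod_cast h1
  linarith

/-- If `ℓ` had a `u`-component, replacing `m` by `m - c ℓ` would remove that of `m` without changing
`ℓ ∧ m`. The new vector is transversally isotropic, so exactly one of `zform`, `zbform` vanishes on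
`ℓ ∧ m`, and `Ψ₀` is a non-zero multiple of `A` or of `Ā`. -/
lemma Tetrad.IsNull.l_u_eq_zero (hU : IsOpen U) (hA : ContDiffOn ℝ ∞ A U) {p : Fin 4 → ℝ}
    (hp : p 2 ∈ U) (hA0 : A (p 2) ≠ 0) {E : Tetrad} (hE : E.IsNull (metric A p))
    (h0 : Psi0 (metric A) p E = 0) : E.l 2 = 0 := by
  by_contra hl
  have hlC : ((E.l 2 : ℝ) : ℂ) ≠ 0 := by exact_mod_cast hl
  obtain ⟨c, hc⟩ : ∃ c : ℂ, E.m 2 = c * E.l 2 := ⟨E.m 2 / E.l 2, by field_simp⟩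
  have ll := hE.ll
  have mm := hE.mm
  have lm := hE.lm
  have mmb := hE.mmbar
  have lmb := congrArg (starRingEnd ℂ) hE.lm
  simp only [ip_metric, Tetrad.mbar, conjV, toC, map_sub, map_add, map_mul, Complex.conj_ofReal,
    map_zero, map_ofNat, hc] at ll mm lm mmb lmb
  obtain ⟨hs, hn⟩ := transverse_null (m₀ := E.m 0 - c * E.l 0) (m₁ := E.m 1 - c * E.l 1)
    (by linear_combination mm - 2 * c * lm + c ^ 2 * ll)
    (by
      simp only [map_sub, map_mul, Complex.conj_ofReal]
      linear_combination mmb - c * lmb - starRingEnd ℂ c * lm + c * starRingEnd ℂ c * ll)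
  have hm : E.m 0 - c * E.l 0 ≠ 0 := by
    intro h; rw [h] at hn; norm_num at hn
  rw [Psi0, weylC_metric hU hA hp] at h0
  rcases hs with hs | hs
  · have hz : zform (toC E.l) E.m = 0 := by
      simp only [zform, toC, hc]
      linear_combination (-E.l 2 * Complex.I) * hs - E.l 2 * (E.m 0 - c * E.l 0) * Complex.I_sq
    have hzb : zbform (toC E.l) E.m = -2 * E.l 2 * (E.m 0 - c * E.l 0) := by
      simp only [zbform, toC, hc]
      linear_combination (E.l 2 * Complex.I) * hs + E.l 2 * (E.m 0 - c * E.l 0) * Complex.I_sq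
    simp [hz, hzb, hA0, hl, hm] at h0
  · have hz : zbform (toC E.l) E.m = 0 := by
      simp only [zbform, toC, hc]
      linear_combination (E.l 2 * Complex.I) * hs - E.l 2 * (E.m 0 - c * E.l 0) * Complex.I_sq
    have hzb : zform (toC E.l) E.m = -2 * E.l 2 * (E.m 0 - c * E.l 0) := by
      simp only [zform, toC, hc]
      linear_combination (-E.l 2 * Complex.I) * hs + E.l 2 * (E.m 0 - c * E.l 0) * Complex.I_sq
    simp [hz, hzb, hA0, hl, hm] at h0

/-- The components of a null tetrad aligned with `∂_v`. -/
lemma Tetrad.IsNull.aligned {p : Fin 4 → ℝ} {E : Tetrad} (hE : E.IsNull (metric A p))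
    (hl : E.l 2 = 0) : E.m 2 = 0 ∧ (E.m 1 = Complex.I * E.m 0 ∨ E.m 1 = -(Complex.I * E.m 0)) ∧
      ‖E.m 0‖ ^ 2 = 1 / 2 := by
  have ll := hE.ll
  have lm := hE.lm
  have ln := hE.ln
  have mm := hE.mm
  have mmb := hE.mmbar
  simp only [ip_metric, Tetrad.mbar, conjV, toC, hl, Complex.ofReal_zero] at ll lm ln mm mmb
  have llr : E.l 0 ^ 2 + E.l 1 ^ 2 = 0 := by
    have : ((E.l 0 ^ 2 + E.l 1 ^ 2 : ℝ) : ℂ) = 0 := by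
      push_cast; linear_combination ll
    exact_mod_cast this
  have l0 : E.l 0 = 0 := by nlinarith [sq_nonneg (E.l 0), sq_nonneg (E.l 1)]
  have l1 : E.l 1 = 0 := by nlinarith [sq_nonneg (E.l 0), sq_nonneg (E.l 1)]
  rw [l0, l1, Complex.ofReal_zero] at lm ln
  have hm : E.m 2 = 0 := by
    have : (E.l 3 : ℂ) ≠ 0 := by
      intro h; rw [h] at ln; norm_num at ln
    have h : (E.l 3 : ℂ) * E.m 2 = 0 := by linear_combination -lm
    exact (mul_eq_zero.1 h).resolve_left this
  rw [hm] at mm mmb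
  exact ⟨hm, transverse_null (by linear_combination mm)
    (by simp only [map_zero] at mmb; linear_combination mmb)⟩

/-- The two cases are the two orientations of the transverse frame; the wrong one exchanges `A` and
`Ā`. -/
lemma Psi4_aligned (hU : IsOpen U) (hA : ContDiffOn ℝ ∞ A U) {p : Fin 4 → ℝ}
    (hp : p 2 ∈ U) {E : Tetrad} (hm : E.m 2 = 0) :
    (E.m 1 = Complex.I * E.m 0 → Psi4 (metric A) p E
      = 2 * A (p 2) * (E.n 2) ^ 2 * starRingEnd ℂ (E.m 0) ^ 2) ∧
    (E.m 1 = -(Complex.I * E.m 0) → Psi4 (metric A) p E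
      = 2 * starRingEnd ℂ (A (p 2)) * (E.n 2) ^ 2 * starRingEnd ℂ (E.m 0) ^ 2) := by
  rw [Psi4, weylC_metric hU hA hp]
  constructor <;> intro h <;>
  simp only [zform, zbform, Tetrad.mbar, conjV, toC, hm, h, map_zero, map_neg, map_mul,
    Complex.conj_I] <;> grind [Complex.I_sq]

end Tetrads

/-! ### Canonical tetrads and reality of `γ_c`. -/

section Polarization
variable {A : ℝ → ℂ} {U : Set ℝ}

/-- The profile `A` has on `U` the constant phase `φ` modulo `π`. -/
def ProfilePhase (A : ℝ → ℂ) (U : Set ℝ) (φ : ℝ) : Prop :=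
  ∃ s : ℝ, (s = 1 ∨ s = -1) ∧
    ∀ u ∈ U, A u = (s : ℂ) * (‖A u‖ : ℂ) * Complex.exp (Complex.I * (φ : ℂ))

lemma ProfilePhase.exists_unit {φ : ℝ} (h : ProfilePhase A U φ) :
    ∃ κ : ℂ, ‖κ‖ = 1 ∧ ∀ u ∈ U, A u = (‖A u‖ : ℂ) * κ := by
  obtain ⟨s, hs, h⟩ := h
  refine ⟨s * Complex.exp (Complex.I * φ), ?_, fun u hu => ?_⟩
  · rw [norm_mul, mul_comm Complex.I, Complex.norm_exp_ofReal_mul_I]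
    rcases hs with rfl | rfl <;> simp
  · rw [← mul_assoc, mul_comm (‖A u‖ : ℂ)]; exact h u hu

lemma finite_sq_eq (c : ℂ) : {f : ℂ | f ^ 2 = c}.Finite := by
  obtain ⟨r, hr⟩ := IsAlgClosed.exists_pow_nat_eq c (n := 2) (by norm_num)
  refine (Set.toFinite {r, -r}).subset fun f hf => ?_
  rw [Set.mem_ofPred_eq, ← hr] at hf
  simpa using sq_eq_sq_iff_eq_or_eq_neg.1 hf

/-- Taking norms gives `|α| n² = 1`, so the boost cancels and only the phase `κ` of `α` is left to
determine `f²`. -/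
lemma sq_eq_of_unit {α κ f : ℂ} {n : ℝ} (hκ : ‖κ‖ = 1) (hα : α = (‖α‖ : ℂ) * κ)
    (hf : ‖f‖ ^ 2 = 1 / 2) (h : 2 * α * (n : ℂ) ^ 2 * f ^ 2 = 1) : f ^ 2 = 1 / (2 * κ) := by
  have hn := congrArg norm h
  simp only [norm_mul, norm_pow, hf, Complex.norm_real, norm_one, Real.norm_eq_abs, sq_abs,
    Complex.norm_ofNat] at hn
  have hn' : ‖α‖ * n ^ 2 = 1 := by linarith
  have hnC : (‖α‖ : ℂ) * (n : ℂ) ^ 2 = 1 := by exact_mod_cast hn'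
  have hκ0 : κ ≠ 0 := by rintro rfl; simp at hκ
  rw [hα] at h
  rw [eq_div_iff (by simpa using hκ0)]
  linear_combination h - 2 * κ * f ^ 2 * hnC

/-- A continuous function with values in a finite set is locally constant. -/
lemma eventually_eq_of_finite {X Y : Type*} [TopologicalSpace X] [TopologicalSpace Y] [T1Space Y]
    {f : X → Y} {p : X} {S : Set Y} (hS : S.Finite) (hf : ContinuousAt f p)
    (h : ∀ᶠ q in nhds p, f q ∈ S) : ∀ᶠ q in nhds p, f q = f p := by
  have hc : (S \ {f p})ᶜ ∈ nhds (f p) :=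
    (hS.subset Set.sdiff_subset).isClosed.isOpen_compl.mem_nhds (by simp)
  filter_upwards [h, hf.eventually hc] with q h1 h2
  by_contra hne
  exact h2 ⟨h1, hne⟩

/-- Here the constancy of the phase enters: the finite set does not depend on the point. -/
lemma IsCanonical.transverse_finite (hU : IsOpen U) (hA : ContDiffOn ℝ ∞ A U)
    (hA0 : ∀ u ∈ U, A u ≠ 0) {κ : ℂ} (hκ : ‖κ‖ = 1) (hAκ : ∀ u ∈ U, A u = (‖A u‖ : ℂ) * κ)
    {W : Set (Fin 4 → ℝ)} {E : (Fin 4 → ℝ) → Tetrad} (hE : IsCanonical (metric A) W E) :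
    ∃ S : Set ℂ, S.Finite ∧ ∀ q ∈ W, q 2 ∈ U →
      (E q).m 2 = 0 ∧ (E q).mbar 0 ∈ S ∧ (E q).mbar 1 ∈ S := by
  -- One square-root equation for each orientation of `m`.
  set R : Set ℂ := {f | f ^ 2 = 1 / (2 * κ)} ∪ {f | f ^ 2 = 1 / (2 * starRingEnd ℂ κ)}
  have hR : R.Finite := (finite_sq_eq _).union (finite_sq_eq _)
  refine ⟨R ∪ ((fun z => Complex.I * z) '' R ∪ (fun z => -(Complex.I * z)) '' R),
    hR.union ((hR.image _).union (hR.image _)), fun q hqW hqU => ?_⟩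
  have hl := (hE.null q hqW).l_u_eq_zero hU hA hqU (hA0 _ hqU) (hE.psi0 q hqW)
  obtain ⟨hm2, hm1, hm0⟩ := (hE.null q hqW).aligned hl
  have h4 := hE.psi4 q hqW
  have hψ := Psi4_aligned hU hA hqU hm2
  have hf : ‖starRingEnd ℂ ((E q).m 0)‖ ^ 2 = 1 / 2 := by simpa using hm0
  have hA1 := hAκ _ hqU
  have hA2 : starRingEnd ℂ (A (q 2)) = (‖starRingEnd ℂ (A (q 2))‖ : ℂ) * starRingEnd ℂ κ := by
    conv_lhs => rw [hA1]
    simp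
  have hmem : (E q).mbar 0 ∈ R := by
    rcases hm1 with h | h
    · exact Or.inl (sq_eq_of_unit hκ hA1 hf ((hψ.1 h).symm.trans h4))
    · exact Or.inr (sq_eq_of_unit (by simpa using hκ) hA2 hf ((hψ.2 h).symm.trans h4))
  refine ⟨hm2, Or.inl hmem, Or.inr ?_⟩
  rcases hm1 with h | h
  · exact Or.inr ⟨_, hmem, by simp [Tetrad.mbar, conjV, h]⟩
  · exact Or.inl ⟨_, hmem, by simp [Tetrad.mbar, conjV, h]⟩

lemma ip_covDeriv_real_im (g : (Fin 4 → ℝ) → Matrix (Fin 4) (Fin 4) ℝ) {p X : Fin 4 → ℝ}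
    {Y : (Fin 4 → ℝ) → Fin 4 → ℝ} (hY : DifferentiableAt ℝ Y p) (Z : Fin 4 → ℝ) :
    (ip (g p) (covDeriv g p X fun q => toC (Y q)) (toC Z)).im = 0 := by
  have h : ∀ a, covDeriv g p X (fun q => toC (Y q)) a
      = ((fderiv ℝ (fun q => Y q a) p X
        + ∑ b, ∑ c, christoffel g p a b c * X b * Y p c : ℝ) : ℂ) := by
    intro a
    have hd := (differentiableAt_pi.1 hY a).hasFDerivAt
    have : HasFDerivAt (fun q => toC (Y q) a) _ p := (Complex.ofRealCLM.hasFDerivAt).comp p hd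
    rw [covDeriv, this.fderiv]
    simp [toC]
  simp only [ip, h, toC]
  have : ∀ x y z : ℝ, (x : ℂ) * y * z = ((x * y * z : ℝ) : ℂ) := by intros; push_cast; rfl
  simp only [this, ← Complex.ofReal_sum, Complex.ofReal_im]

/-- The term with `m̄` vanishes, and the other is built from real fields and a real connection. -/
lemma IsCanonical.spinGamma_im (hU : IsOpen U) (hA : ContDiffOn ℝ ∞ A U)
    (hA0 : ∀ u ∈ U, A u ≠ 0) {κ : ℂ} (hκ : ‖κ‖ = 1) (hAκ : ∀ u ∈ U, A u = (‖A u‖ : ℂ) * κ)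
    {W : Set (Fin 4 → ℝ)} (hW : IsOpen W) {E : (Fin 4 → ℝ) → Tetrad}
    (hE : IsCanonical (metric A) W E) {p : Fin 4 → ℝ} (hp : p ∈ W) (hpU : p 2 ∈ U) :
    (spinGamma (metric A) E p).im = 0 := by
  obtain ⟨S, hS, hE'⟩ := hE.transverse_finite hU hA hA0 hκ hAκ
  have hnear : ∀ᶠ q in nhds p, q ∈ W ∧ q 2 ∈ U :=
    (hW.eventually_mem hp).and
      ((continuous_apply 2).continuousAt.eventually (hU.mem_nhds hpU))
  have hcont : ∀ a, ContinuousAt (fun q => (E q).mbar a) p := fun a =>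
    Complex.continuous_conj.continuousAt.comp
      (continuousAt_pi.1 (hE.smooth_m.continuousOn.continuousAt (hW.mem_nhds hp)) a)
  have hder : ∀ a : Fin 4, a ≠ 3 → fderiv ℝ (fun q => (E q).mbar a) p = 0 := by
    intro a ha
    have : (fun q => (E q).mbar a) =ᶠ[nhds p] fun _ => (E p).mbar a := by
      fin_cases a
      · exact eventually_eq_of_finite hS (hcont 0) (hnear.mono fun q h => (hE' q h.1 h.2).2.1)
      · exact eventually_eq_of_finite hS (hcont 1) (hnear.mono fun q h => (hE' q h.1 h.2).2.2)
      · refine hnear.mono fun q h => ?_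
        simp [Tetrad.mbar, conjV, (hE' q h.1 h.2).1, (hE' p hp hpU).1]
      · exact absurd rfl ha
    rw [this.fderiv_eq]; simp
  have hm2 := (hE' p hp hpU).1
  have hmb2 : (E p).mbar 2 = 0 := by simp [Tetrad.mbar, conjV, hm2]
  have hcov : ∀ a : Fin 4, a ≠ 3 →
      covDeriv (metric A) p (E p).n (fun q => (E q).mbar) a = 0 := by
    intro a ha
    have hev : ev a = 0 := by fin_cases a <;> simp [ev] at ha ⊢
    rw [covDeriv, hder a ha]
    simp [christoffel_metric hU hA hpU, hev, Fin.sum_univ_four, du, hmb2]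
  -- The covariant derivative of `m̄` is a multiple of `∂_v`, which is orthogonal to `m` since `m`
  -- has no `u`-component.
  have h2 : ip (metric A p) (covDeriv (metric A) p (E p).n fun q => (E q).mbar) (E p).m = 0 := by
    rw [ip_metric, hcov 0 (by decide), hcov 1 (by decide), hcov 2 (by decide), hm2]
    ring
  have h1 := ip_covDeriv_real_im (metric A) (X := (E p).n) (Z := (E p).l)
    ((hE.smooth_n.contDiffAt (hW.mem_nhds hp)).differentiableAt (by simp))
  rw [spinGamma, h2, sub_zero, Complex.mul_im, h1]
  norm_num

lemma contDiffOn_profileH (hA : ContDiffOn ℝ ∞ A U) :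
    ContDiffOn ℝ ∞ (profileH A) {p | p 2 ∈ U} := by
  have hu : ContDiffOn ℝ ∞ (fun p : Fin 4 → ℝ => p 2) {p | p 2 ∈ U} := by fun_prop
  have ha := (contDiffOn_reA hA).comp hu fun p hp => hp
  have hb := (contDiffOn_imA hA).comp hu fun p hp => hp
  have h0 : ContDiffOn ℝ ∞ (fun p : Fin 4 → ℝ => p 0) {p | p 2 ∈ U} := by fun_prop
  have h1 : ContDiffOn ℝ ∞ (fun p : Fin 4 → ℝ => p 1) {p | p 2 ∈ U} := by fun_prop
  rw [profileH_eq_quad]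
  exact ((ha.mul ((h0.pow 2).sub (h1.pow 2))).div_const 2).sub (hb.mul (h0.mul h1))

/-- An aligned null tetrad, with boost parameter `N` and constant transverse vector. -/
def alignedTetrad (A : ℝ → ℂ) (N : ℝ → ℝ) (f : ℂ) (p : Fin 4 → ℝ) : Tetrad where
  l := ![0, 0, 0, (N (p 2))⁻¹]
  n := ![0, 0, N (p 2), -(profileH A p * N (p 2))]
  m := ![f, Complex.I * f, 0, 0]

lemma alignedTetrad_isNull (A : ℝ → ℂ) {N : ℝ → ℝ} {f : ℂ} {p : Fin 4 → ℝ} (hN : N (p 2) ≠ 0)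
    (hf : ‖f‖ ^ 2 = 1 / 2) : (alignedTetrad A N f p).IsNull (metric A p) := by
  have hNC : (N (p 2) : ℂ) ≠ 0 := by exact_mod_cast hN
  have hfC : f * starRingEnd ℂ f = 1 / 2 := by
    rw [Complex.mul_conj', ← Complex.ofReal_pow, hf]; norm_num
  constructor <;> rw [ip_metric] <;>
    simp [alignedTetrad, toC, Tetrad.mbar, conjV, hNC]
  · ring
  · linear_combination f ^ 2 * Complex.I_sq
  · linear_combination 2 * hfC - f * starRingEnd ℂ f * Complex.I_sq

lemma exists_isCanonical (hU : IsOpen U) (hA : ContDiffOn ℝ ∞ A U)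
    (hA0 : ∀ u ∈ U, A u ≠ 0) {κ : ℂ} (hκ : ‖κ‖ = 1) (hAκ : ∀ u ∈ U, A u = (‖A u‖ : ℂ) * κ) :
    ∃ E, IsCanonical (metric A) {p | p 2 ∈ U} E := by
  obtain ⟨g, hg⟩ := IsAlgClosed.exists_pow_nat_eq (1 / (2 * κ)) (n := 2) (by norm_num)
  have hκ0 : κ ≠ 0 := by rintro rfl; simp at hκ
  have hgn : ‖starRingEnd ℂ g‖ ^ 2 = 1 / 2 := by
    have := congrArg norm hg
    simpa [hκ] using this
  -- Chosen so that `|A| N² = 1`; with `g² = 1 / (2κ)` this makes `Ψ₄ = 2 A N² g² = 1`.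
  set N : ℝ → ℝ := fun u => (√‖A u‖)⁻¹ with hNdef
  have hpos : ∀ u ∈ U, 0 < ‖A u‖ := fun u hu => norm_pos_iff.2 (hA0 u hu)
  have hs0 : ∀ u ∈ U, √‖A u‖ ≠ 0 := fun u hu => (Real.sqrt_pos.2 (hpos u hu)).ne'
  have hsq : ContDiffOn ℝ ∞ (fun u => √‖A u‖) U :=
    (hA.norm ℝ hA0).sqrt fun u hu => (hpos u hu).ne'
  have hu : ContDiffOn ℝ ∞ (fun p : Fin 4 → ℝ => p 2) {p | p 2 ∈ U} := by fun_prop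
  have hN : ContDiffOn ℝ ∞ (fun p : Fin 4 → ℝ => N (p 2)) {p | p 2 ∈ U} :=
    (hsq.inv hs0).comp hu fun p hp => hp
  have hH := contDiffOn_profileH hA
  have hN0 : ∀ p ∈ {p : Fin 4 → ℝ | p 2 ∈ U}, N (p 2) ≠ 0 := fun p hp => inv_ne_zero (hs0 _ hp)
  refine ⟨alignedTetrad A N (starRingEnd ℂ g), ?_, ?_, ?_, ?_, ?_, ?_, ?_, ?_, ?_⟩
  · refine contDiffOn_pi.2 fun a => ?_
    fin_cases a
    · exact contDiffOn_const
    · exact contDiffOn_const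
    · exact contDiffOn_const
    · exact hN.inv hN0
  · refine contDiffOn_pi.2 fun a => ?_
    fin_cases a
    · exact contDiffOn_const
    · exact contDiffOn_const
    · exact hN
    · exact (hH.mul hN).neg
  · exact contDiffOn_const
  · exact fun p hp => alignedTetrad_isNull A (hN0 p hp) hgn
  · intro p hp
    rw [Psi0, weylC_metric hU hA hp]
    simp [zform, zbform, alignedTetrad, toC]
  · intro p hp
    rw [Psi1, weylC_metric hU hA hp]
    simp [zform, zbform, alignedTetrad, toC]
  · intro p hp
    rw [Psi2, weylC_metric hU hA hp]
    simp [zform, zbform, alignedTetrad, toC]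
  · intro p hp
    rw [Psi3, weylC_metric hU hA hp]
    simp [zform, zbform, alignedTetrad, toC]
  · intro p hp
    rw [(Psi4_aligned hU hA hp rfl).1 rfl]
    have h1 : ‖A (p 2)‖ * N (p 2) ^ 2 = 1 := by
      rw [hNdef]
      simp only [inv_pow, Real.sq_sqrt (norm_nonneg _)]
      exact mul_inv_cancel₀ (hpos _ hp).ne'
    have h1C : (‖A (p 2)‖ : ℂ) * (N (p 2) : ℂ) ^ 2 = 1 := by exact_mod_cast h1
    have h2 : 2 * κ * g ^ 2 = 1 := by rw [hg]; field_simp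
    rw [hAκ _ hp]
    simp only [alignedTetrad, Matrix.cons_val, Complex.conj_conj]
    linear_combination 2 * κ * g ^ 2 * h1C + h2

theorem isLinearlyPolarized (hU : IsOpen U) (hA : ContDiffOn ℝ ∞ A U)
    (hA0 : ∀ u ∈ U, A u ≠ 0) {φ : ℝ} (hφ : ProfilePhase A U φ) : IsLinearlyPolarized A U := by
  obtain ⟨κ, hκ, hAκ⟩ := hφ.exists_unit
  intro p hp
  constructor
  · obtain ⟨E, hE⟩ := exists_isCanonical hU hA hA0 hκ hAκ
    exact ⟨_, _, E, hU.preimage (continuous_apply 2), hp, hE, rfl⟩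
  · rintro c ⟨W, E, hW, hpW, hE, rfl⟩
    exact hE.spinGamma_im hU hA hA0 hκ hAκ hW hpW hp

end Polarization

/-! ### Linear differential equations: uniform existence time and uniqueness. -/

section LinearODE
variable {E : Type*} [NormedAddCommGroup E] [NormedSpace ℝ E]

/-- A linear differential equation is solvable near `c` on an interval that does not depend on
the initial values. -/
lemma exists_uniform_linear_solution [CompleteSpace E] {M : ℝ → E →L[ℝ] E} {D : Set ℝ}
    (hD : IsOpen D) (hM : ContinuousOn M D) {c : ℝ} (hc : c ∈ D) :
    ∃ δ > 0, ∃ C : ℝ, Set.Ioo (c - δ) (c + δ) ⊆ D ∧ (∀ t ∈ Set.Ioo (c - δ) (c + δ), ‖M t‖ ≤ C) ∧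
      ∀ t₀ ∈ Set.Ioo (c - δ) (c + δ), ∀ x₀ : E, ∃ α : ℝ → E, α t₀ = x₀ ∧
        ∀ t ∈ Set.Ioo (c - δ) (c + δ), HasDerivAt α (M t (α t)) t := by
  obtain ⟨C, hC⟩ : ∃ C, C = ‖M c‖ + 1 := ⟨_, rfl⟩
  have hC0 : 0 < C := by rw [hC]; positivity
  have hMc : ∀ᶠ t in nhds c, ‖M t‖ < C :=
    (hM.continuousAt (hD.mem_nhds hc)).norm.eventually_lt_const (by rw [hC]; linarith)
  obtain ⟨ε, hε, hball⟩ := Metric.eventually_nhds_iff.1 (hMc.and (hD.eventually_mem hc))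
  -- The choice of `δ` does not involve `x₀`: on the ball of radius `‖x₀‖ + 1` about `x₀` the field
  -- is at most `C (2‖x₀‖ + 1)`, so in time `2δ` a solution moves by at most `‖x₀‖ + 1/2`.
  obtain ⟨δ, hδ, hδε, hδC⟩ : ∃ δ > 0, δ < ε ∧ 2 * δ * C ≤ 1 / 2 := by
    refine ⟨min (ε / 2) (1 / (4 * C)), by positivity, ?_, ?_⟩
    · exact (min_le_left _ _).trans_lt (by linarith)
    · calc 2 * min (ε / 2) (1 / (4 * C)) * C ≤ 2 * (1 / (4 * C)) * C := by
            gcongr; exact min_le_right _ _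
        _ = 1 / 2 := by field_simp; norm_num
  have hIcc : ∀ t ∈ Set.Icc (c - δ) (c + δ), ‖M t‖ < C ∧ t ∈ D := fun t ht => hball (by
    rw [Real.dist_eq, abs_lt]; constructor <;> linarith [ht.1, ht.2])
  refine ⟨δ, hδ, C, fun t ht => (hIcc t (Set.Ioo_subset_Icc_self ht)).2,
    fun t ht => (hIcc t (Set.Ioo_subset_Icc_self ht)).1.le, fun t₀ ht₀ x₀ => ?_⟩
  have hp : IsPicardLindelof (fun t x => M t x)
      (⟨t₀, Set.Ioo_subset_Icc_self ht₀⟩ : Set.Icc (c - δ) (c + δ)) x₀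
      (‖x₀‖₊ + 1) 0 (C.toNNReal * (2 * ‖x₀‖₊ + 1)) C.toNNReal := by
    constructor
    · intro t ht
      refine ((M t).lipschitz.weaken ?_).lipschitzOnWith
      rw [← NNReal.coe_le_coe, Real.coe_toNNReal _ hC0.le]
      exact (hIcc t ht).1.le
    · exact fun x _ => (hM.mono fun t ht => (hIcc t ht).2).clm_apply continuousOn_const
    · intro t ht x hx
      have hx' : ‖x‖ ≤ 2 * ‖x₀‖ + 1 := by
        have h1 : ‖x - x₀‖ ≤ ‖x₀‖ + 1 := by simpa [dist_eq_norm] using hx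
        have h2 := norm_add_le (x - x₀) x₀
        rw [sub_add_cancel] at h2
        linarith
      push_cast
      rw [Real.coe_toNNReal _ hC0.le]
      exact (M t).le_of_opNorm_le_of_le (hIcc t ht).1.le hx'
    · push_cast
      rw [Real.coe_toNNReal _ hC0.le]
      have hmax : max (c + δ - t₀) (t₀ - (c - δ)) ≤ 2 * δ :=
        max_le (by linarith [ht₀.1]) (by linarith [ht₀.2])
      calc C * (2 * ‖x₀‖ + 1) * max (c + δ - t₀) (t₀ - (c - δ))
          ≤ C * (2 * ‖x₀‖ + 1) * (2 * δ) := by gcongr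
        _ = (2 * δ * C) * (2 * ‖x₀‖ + 1) := by ring
        _ ≤ 1 / 2 * (2 * ‖x₀‖ + 1) := by gcongr
        _ ≤ ‖x₀‖ + 1 - 0 := by linarith
  obtain ⟨α, hα0, hα⟩ := hp.exists_eq_forall_mem_Icc_hasDerivWithinAt₀
  exact ⟨α, hα0, fun t ht => (hα t (Set.Ioo_subset_Icc_self ht)).hasDerivAt
    (Icc_mem_nhds ht.1 ht.2)⟩

lemma linear_solution_unique {M : ℝ → E →L[ℝ] E} {S : Set ℝ} (hS : S.OrdConnected) {C : ℝ}
    (hC : ∀ t ∈ S, ‖M t‖ ≤ C) {f g : ℝ → E} (hf : ∀ t ∈ S, HasDerivAt f (M t (f t)) t)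
    (hg : ∀ t ∈ S, HasDerivAt g (M t (g t)) t) {t₀ : ℝ} (ht₀ : t₀ ∈ S) (h : f t₀ = g t₀) :
    Set.EqOn f g S := by
  intro t ht
  have hlip : ∀ r ∈ S, LipschitzOnWith C.toNNReal (fun x => M r x) Set.univ := fun r hr =>
    ((M r).lipschitz.weaken (by
      rw [← NNReal.coe_le_coe, Real.coe_toNNReal']
      exact (hC r hr).trans (le_max_left _ _))).lipschitzOnWith
  rcases le_total t₀ t with hle | hle
  · have hsub := hS.out ht₀ ht
    have hsub' := Set.Ico_subset_Icc_self.trans hsub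
    exact ODE_solution_unique_of_mem_Icc_right (v := fun t x => M t x) (s := fun _ => Set.univ)
      (fun r hr => hlip r (hsub' hr))
      (HasDerivAt.continuousOn fun r hr => hf r (hsub hr))
      (fun r hr => (hf r (hsub' hr)).hasDerivWithinAt) (fun _ _ => trivial)
      (HasDerivAt.continuousOn fun r hr => hg r (hsub hr))
      (fun r hr => (hg r (hsub' hr)).hasDerivWithinAt) (fun _ _ => trivial) h
      (Set.right_mem_Icc.2 hle)
  · have hsub := hS.out ht ht₀
    have hsub' := Set.Ioc_subset_Icc_self.trans hsub
    exact ODE_solution_unique_of_mem_Icc_left (v := fun t x => M t x) (s := fun _ => Set.univ)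
      (fun r hr => hlip r (hsub' hr))
      (HasDerivAt.continuousOn fun r hr => hf r (hsub hr))
      (fun r hr => (hf r (hsub' hr)).hasDerivWithinAt) (fun _ _ => trivial)
      (HasDerivAt.continuousOn fun r hr => hg r (hsub hr))
      (fun r hr => (hg r (hsub' hr)).hasDerivWithinAt) (fun _ _ => trivial) h
      (Set.left_mem_Icc.2 hle)

end LinearODE

/-! ### Timelike geodesics: equations, affine `u`, gluing. -/

section Geodesics
variable {A : ℝ → ℂ} {U : Set ℝ}

/-- The coordinate acceleration of a geodesic with velocity `v` at `p`. -/
def accel (A : ℝ → ℂ) (p v : Fin 4 → ℝ) (a : Fin 4) : ℝ :=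
  -(ev a * (2 * (gradH A p 0 * v 0 + gradH A p 1 * v 1) * v 2 + gradH A p 2 * v 2 ^ 2)
    + transv a * gradH A p a * v 2 ^ 2)

lemma sum_christoffel (hU : IsOpen U) (hA : ContDiffOn ℝ ∞ A U) {p : Fin 4 → ℝ} (hp : p 2 ∈ U)
    (v : Fin 4 → ℝ) (a : Fin 4) :
    ∑ b, ∑ c, christoffel (metric A) p a b c * v b * v c = -accel A p v a := by
  have h3 : gradH A p 3 = 0 := rfl
  simp only [christoffel_metric hU hA hp, tgradH_eq, accel]
  simp [Fin.sum_univ_four, h3, show du 0 = 0 from rfl, show du 1 = 0 from rfl,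
    show du 2 = 1 from rfl, show du 3 = 0 from rfl]
  ring

lemma sum_metric (A : ℝ → ℂ) (p X Y : Fin 4 → ℝ) :
    ∑ a, ∑ b, metric A p a b * X a * Y b
      = X 0 * Y 0 + X 1 * Y 1 - 2 * profileH A p * X 2 * Y 2 - X 2 * Y 3 - X 3 * Y 2 := by
  simp [metric, Fin.sum_univ_four]
  ring

/-- The `C²` regularity is bootstrapped from the equation: the acceleration is a continuous
expression in position and velocity. -/
lemma isTimelikeGeodesic_of_hasDerivAt (hU : IsOpen U) (hA : ContDiffOn ℝ ∞ A U) {S : Set ℝ}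
    (hS : IsOpen S) (hSc : S.OrdConnected) (hSn : S.Nonempty) {y w : ℝ → Fin 4 → ℝ}
    (hy : ∀ t ∈ S, HasDerivAt y (w t) t) (hw : ∀ t ∈ S, HasDerivAt w (accel A (y t) (w t)) t)
    (hmem : ∀ t ∈ S, y t 2 ∈ U)
    (htl : ∀ t ∈ S, ∑ a, ∑ b, metric A (y t) a b * w t a * w t b = -1) :
    IsTimelikeGeodesic A U S y := by
  have hdy : Set.EqOn (deriv y) w S := fun t ht => (hy t ht).deriv
  have hddy : ∀ t ∈ S, deriv (deriv y) t = accel A (y t) (w t) := fun t ht => by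
    rw [(hdy.eventuallyEq_of_mem (hS.mem_nhds ht)).deriv_eq, (hw t ht).deriv]
  have hdw : Set.EqOn (deriv w) (fun t => accel A (y t) (w t)) S := fun t ht => (hw t ht).deriv
  have hyc : ContinuousOn y S := HasDerivAt.continuousOn hy
  have hwc : ContinuousOn w S := HasDerivAt.continuousOn hw
  have hg : ∀ i, ContinuousOn (fun t => gradH A (y t) i) S := by
    intro i t ht
    exact ((hasFDerivAt_gradH hU hA (hmem t ht) i).1.continuousAt.comp
      (hyc.continuousAt (hS.mem_nhds ht))).continuousWithinAt
  have hwi : ∀ i, ContinuousOn (fun t => w t i) S := fun i => continuousOn_pi.1 hwc i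
  have hac : ContinuousOn (fun t => accel A (y t) (w t)) S := by
    refine continuousOn_pi.2 fun a => ?_
    exact ((continuousOn_const.mul (((continuousOn_const.mul (((hg 0).mul (hwi 0)).add
      ((hg 1).mul (hwi 1)))).mul (hwi 2)).add ((hg 2).mul ((hwi 2).pow 2)))).add
        ((continuousOn_const.mul (hg a)).mul ((hwi 2).pow 2))).neg
  have hw1 : ContDiffOn ℝ 1 w S := by
    rw [show (1 : WithTop ℕ∞) = 0 + 1 from rfl, contDiffOn_succ_iff_deriv_of_isOpen hS]
    exact ⟨fun t ht => (hw t ht).differentiableAt.differentiableWithinAt, by simp,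
      contDiffOn_zero.2 (hac.congr hdw)⟩
  refine ⟨hS, hSc, hSn, ?_, hmem, fun t ht => by rw [hdy ht]; exact htl t ht, fun t ht a => ?_⟩
  · rw [show (2 : WithTop ℕ∞) = 1 + 1 by norm_num, contDiffOn_succ_iff_deriv_of_isOpen hS]
    exact ⟨fun t ht => (hy t ht).differentiableAt.differentiableWithinAt, by simp,
      hw1.congr hdy⟩
  · rw [hddy t ht, hdy ht, sum_christoffel hU hA (hmem t ht)]
    ring

namespace IsTimelikeGeodesic
variable {T : Set ℝ} {x : ℝ → Fin 4 → ℝ}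

lemma hasDerivAt (hx : IsTimelikeGeodesic A U T x) {t : ℝ} (ht : t ∈ T) :
    HasDerivAt x (deriv x t) t :=
  ((hx.contDiffOn.contDiffAt (hx.isOpen.mem_nhds ht)).differentiableAt (by simp)).hasDerivAt

lemma hasDerivAt_deriv (hU : IsOpen U) (hA : ContDiffOn ℝ ∞ A U)
    (hx : IsTimelikeGeodesic A U T x) {t : ℝ} (ht : t ∈ T) :
    HasDerivAt (deriv x) (accel A (x t) (deriv x t)) t := by
  have h1 : ContDiffOn ℝ 1 (deriv x) T :=
    hx.contDiffOn.deriv_of_isOpen hx.isOpen (by norm_num)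
  have h2 := ((h1.contDiffAt (hx.isOpen.mem_nhds ht)).differentiableAt (by simp)).hasDerivAt
  rw [show accel A (x t) (deriv x t) = deriv (deriv x) t from ?_]
  · exact h2
  funext a
  have := hx.geodesic t ht a
  rw [sum_christoffel hU hA (hx.mem t ht)] at this
  linarith

/-- With `u̇ = 0` the normalization would read `ẋ² + ẏ² = -1`. -/
lemma deriv_u_ne_zero (hx : IsTimelikeGeodesic A U T x) {t : ℝ} (ht : t ∈ T) :
    deriv x t 2 ≠ 0 := by
  intro h
  have := hx.timelike t ht
  rw [sum_metric, h] at this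
  nlinarith [sq_nonneg (deriv x t 0), sq_nonneg (deriv x t 1)]

/-- All `Γ^u_{bc}` vanish, so `ü = 0`. -/
lemma u_affine (hU : IsOpen U) (hA : ContDiffOn ℝ ∞ A U) (hx : IsTimelikeGeodesic A U T x) :
    ∃ k u₀ : ℝ, k ≠ 0 ∧ ∀ t ∈ T, deriv x t 2 = k ∧ x t 2 = u₀ + k * t := by
  obtain ⟨t₀, ht₀⟩ := hx.nonempty
  have hpre : IsPreconnected T := hx.ordConnected.isPreconnected
  have hd2 : ∀ t ∈ T, HasDerivAt (fun t => deriv x t 2) 0 t := fun t ht => by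
    have := hasDerivAt_pi.1 (hx.hasDerivAt_deriv hU hA ht) 2
    simpa [accel, ev, transv] using this
  have hk : ∀ t ∈ T, deriv x t 2 = deriv x t₀ 2 := fun t ht =>
    hx.isOpen.is_const_of_deriv_eq_zero hpre
      (fun r hr => (hd2 r hr).differentiableAt.differentiableWithinAt)
      (fun r hr => (hd2 r hr).deriv) ht ht₀
  have haff : ∀ t : ℝ, HasDerivAt (fun t => x t₀ 2 - deriv x t₀ 2 * t₀ + deriv x t₀ 2 * t)
      (deriv x t₀ 2) t := fun t => by
    have := (hasDerivAt_id' t).const_mul (deriv x t₀ 2)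
    rw [mul_one] at this
    exact this.const_add (x t₀ 2 - deriv x t₀ 2 * t₀)
  have hx2 : ∀ t ∈ T, HasDerivAt (fun t => x t 2) (deriv x t 2) t := fun t ht =>
    hasDerivAt_pi.1 (hx.hasDerivAt ht) 2
  have heq := hx.isOpen.eqOn_of_deriv_eq hpre
    (fun t ht => (hx2 t ht).differentiableAt.differentiableWithinAt)
    (fun t _ => (haff t).differentiableAt.differentiableWithinAt)
    (fun t ht => by rw [(hx2 t ht).deriv, (haff t).deriv, hk t ht]) ht₀ (by ring)
  exact ⟨_, _, hx.deriv_u_ne_zero ht₀, fun t ht => ⟨hk t ht, heq ht⟩⟩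

/-- Two geodesics that agree where both are defined form one geodesic. -/
lemma glue {T' : Set ℝ} {z : ℝ → Fin 4 → ℝ} (hx : IsTimelikeGeodesic A U T x)
    (hz : IsTimelikeGeodesic A U T' z) (heq : Set.EqOn x z (T ∩ T'))
    (hc : (T ∪ T').OrdConnected) :
    ∃ y, Set.EqOn y x T ∧ IsTimelikeGeodesic A U (T ∪ T') y := by
  classical
  set y := T.piecewise x z
  have hyx : Set.EqOn y x T := T.piecewise_eqOn x z
  have hyz : Set.EqOn y z T' := fun t ht => by
    by_cases h : t ∈ T
    · rw [hyx h, heq ⟨h, ht⟩]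
    · exact T.piecewise_eqOn_compl x z h
  have hloc : ∀ t ∈ T ∪ T', ∃ S r, t ∈ S ∧ IsTimelikeGeodesic A U S r ∧
      y =ᶠ[nhds t] r := by
    rintro t (ht | ht)
    · exact ⟨T, x, ht, hx, hyx.eventuallyEq_of_mem (hx.isOpen.mem_nhds ht)⟩
    · exact ⟨T', z, ht, hz, hyz.eventuallyEq_of_mem (hz.isOpen.mem_nhds ht)⟩
  refine ⟨y, hyx, hx.isOpen.union hz.isOpen, hc, hx.nonempty.inl, ?_, ?_, ?_, ?_⟩
  · intro t ht
    obtain ⟨S, r, htS, hr, hyr⟩ := hloc t ht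
    exact ((hr.contDiffOn.contDiffAt (hr.isOpen.mem_nhds htS)).congr_of_eventuallyEq
      hyr).contDiffWithinAt
  · intro t ht
    obtain ⟨S, r, htS, hr, hyr⟩ := hloc t ht
    rw [hyr.eq_of_nhds]
    exact hr.mem t htS
  · intro t ht
    obtain ⟨S, r, htS, hr, hyr⟩ := hloc t ht
    rw [hyr.eq_of_nhds, hyr.deriv_eq]
    exact hr.timelike t htS
  · intro t ht a
    obtain ⟨S, r, htS, hr, hyr⟩ := hloc t ht
    rw [hyr.eq_of_nhds, hyr.deriv.deriv_eq, hyr.deriv_eq]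
    exact hr.geodesic t htS a

end IsTimelikeGeodesic
end Geodesics

/-! ### Continuation of geodesics and inextendibility. -/

section Extension
variable {A : ℝ → ℂ} {U : Set ℝ}

/-- The map `(z, w) ↦ (w, 0)`. -/
def driftCLM : ℂ × ℂ →L[ℝ] ℂ × ℂ :=
  (ContinuousLinearMap.snd ℝ ℂ ℂ).prod 0

/-- The map `(z, w) ↦ (0, -k² z̄)`. -/
def tidalCLM (k : ℝ) : ℂ × ℂ →L[ℝ] ℂ × ℂ :=
  (0 : ℂ × ℂ →L[ℝ] ℂ).prod
    ((-k ^ 2) • ((Complex.conjCLE : ℂ →L[ℝ] ℂ).comp (ContinuousLinearMap.fst ℝ ℂ ℂ)))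

/-- The generator of the transverse motion `z̈ = -k² Ā z̄`, `z = x + i y`, along `u = u₀ + k t`. -/
def transverseGen (A : ℝ → ℂ) (k u₀ t : ℝ) : ℂ × ℂ →L[ℝ] ℂ × ℂ :=
  driftCLM + (starRingEnd ℂ (A (u₀ + k * t))) • tidalCLM k

lemma transverseGen_apply (A : ℝ → ℂ) (k u₀ t : ℝ) (z : ℂ × ℂ) :
    transverseGen A k u₀ t z
      = (z.2, -k ^ 2 * (starRingEnd ℂ (A (u₀ + k * t)) * starRingEnd ℂ z.1)) := by
  apply Prod.ext
  · simp [transverseGen, driftCLM, tidalCLM]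
  · simp [transverseGen, driftCLM, tidalCLM]
    ring

lemma continuousOn_transverseGen (hA : ContDiffOn ℝ ∞ A U) (k u₀ : ℝ) :
    ContinuousOn (transverseGen A k u₀) {t | u₀ + k * t ∈ U} := by
  have h1 : ContinuousOn (fun t : ℝ => A (u₀ + k * t)) {t | u₀ + k * t ∈ U} :=
    hA.continuousOn.comp (by fun_prop) fun t ht => ht
  exact continuousOn_const.add
    ((Complex.continuous_conj.comp_continuousOn h1).smul continuousOn_const)

lemma transverseGen_eq_accel {p v : Fin 4 → ℝ} {k u₀ t : ℝ} (hp : p 2 = u₀ + k * t)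
    (hv : v 2 = k) {z : ℂ} (hz : z = ⟨p 0, p 1⟩) (w : ℂ) :
    transverseGen A k u₀ t (z, w) = (w, ⟨accel A p v 0, accel A p v 1⟩) := by
  rw [transverseGen_apply, ← hp]
  refine Prod.ext rfl ?_
  rw [← Complex.ofReal_pow, ← Complex.ofReal_neg]
  apply Complex.ext
  · rw [Complex.re_ofReal_mul]
    simp [hz, accel, ev, transv, gradH, lin, reA, imA, hv]
    ring
  · rw [Complex.im_ofReal_mul]
    simp [hz, accel, ev, transv, gradH, lin, reA, imA, hv]
    ring

lemma hasDerivAt_complex_mk {f g : ℝ → ℝ} {f' g' t : ℝ} (hf : HasDerivAt f f' t)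
    (hg : HasDerivAt g g' t) : HasDerivAt (fun s => (⟨f s, g s⟩ : ℂ)) ⟨f', g'⟩ t := by
  have h := hf.ofReal_comp.add (hg.ofReal_comp.mul_const Complex.I)
  rw [Complex.mk_eq_add_mul_I]
  exact h.congr_of_eventuallyEq (.of_forall fun s => Complex.mk_eq_add_mul_I _ _)

/-- The rate of change of `v` along a unit timelike curve. -/
def vdot (A : ℝ → ℂ) (k : ℝ) (p : Fin 4 → ℝ) (v₀ v₁ : ℝ) : ℝ :=
  (1 + v₀ ^ 2 + v₁ ^ 2 - 2 * profileH A p * k ^ 2) / (2 * k)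

/-- Since `u̇ ≠ 0`, the normalization is linear in `v̇` and can be solved for it; `v` thus needs no
differential equation of its own. -/
lemma timelike_iff {k : ℝ} (hk : k ≠ 0) {p v : Fin 4 → ℝ} (hv : v 2 = k) :
    ∑ a, ∑ b, metric A p a b * v a * v b = -1 ↔ v 3 = vdot A k p (v 0) (v 1) := by
  rw [sum_metric, hv, vdot, eq_div_iff (by simpa using hk)]
  constructor <;> intro h <;> linarith

lemma IsTimelikeGeodesic.hasDerivAt_transverse (hU : IsOpen U) (hA : ContDiffOn ℝ ∞ A U)
    {T : Set ℝ} {x : ℝ → Fin 4 → ℝ} (hx : IsTimelikeGeodesic A U T x) {k u₀ : ℝ}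
    (hk : ∀ t ∈ T, deriv x t 2 = k ∧ x t 2 = u₀ + k * t) {t : ℝ} (ht : t ∈ T) :
    HasDerivAt (fun t => ((⟨x t 0, x t 1⟩ : ℂ), (⟨deriv x t 0, deriv x t 1⟩ : ℂ)))
      (transverseGen A k u₀ t (⟨x t 0, x t 1⟩, ⟨deriv x t 0, deriv x t 1⟩)) t := by
  rw [transverseGen_eq_accel (hk t ht).2 (hk t ht).1 rfl]
  have h1 := hasDerivAt_pi.1 (hx.hasDerivAt ht)
  have h2 := hasDerivAt_pi.1 (hx.hasDerivAt_deriv hU hA ht)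
  exact (hasDerivAt_complex_mk (h1 0) (h1 1)).prodMk (hasDerivAt_complex_mk (h2 0) (h2 1))

/-- A solution of the transverse equations lifts to a timelike geodesic. -/
lemma exists_isTimelikeGeodesic_of_transverse (hU : IsOpen U) (hA : ContDiffOn ℝ ∞ A U)
    {k u₀ : ℝ} (hk : k ≠ 0) {S : Set ℝ} (hS : IsOpen S) (hSc : S.OrdConnected) {t₀ : ℝ}
    (ht₀ : t₀ ∈ S) (hSU : ∀ t ∈ S, u₀ + k * t ∈ U) {α : ℝ → ℂ × ℂ}
    (hα : ∀ t ∈ S, HasDerivAt α (transverseGen A k u₀ t (α t)) t) (v₀ : ℝ) :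
    ∃ y, IsTimelikeGeodesic A U S y ∧ y t₀ 3 = v₀ ∧ ∀ t ∈ S,
      y t 0 = (α t).1.re ∧ y t 1 = (α t).1.im ∧ y t 2 = u₀ + k * t ∧
      HasDerivAt (fun t => y t 3) (vdot A k (y t) (α t).2.re (α t).2.im) t := by
  have hz : ∀ t ∈ S, HasDerivAt (fun t => (α t).1) (α t).2 t := fun t ht => by
    have := (hα t ht).fst
    rwa [transverseGen_apply] at this
  have hw : ∀ t ∈ S, HasDerivAt (fun t => (α t).2) (transverseGen A k u₀ t (α t)).2 t :=
    fun t ht => (hα t ht).snd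
  have hre : ∀ {f : ℝ → ℂ} {f' : ℂ} {t : ℝ}, HasDerivAt f f' t →
      HasDerivAt (fun t => (f t).re) f'.re t := fun h =>
    Complex.reCLM.hasFDerivAt.comp_hasDerivAt _ h
  have him : ∀ {f : ℝ → ℂ} {f' : ℂ} {t : ℝ}, HasDerivAt f f' t →
      HasDerivAt (fun t => (f t).im) f'.im t := fun h =>
    Complex.imCLM.hasFDerivAt.comp_hasDerivAt _ h
  have hu : ∀ t : ℝ, HasDerivAt (fun t => u₀ + k * t) k t := fun t => by
    have := (hasDerivAt_id' t).const_mul k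
    rw [mul_one] at this
    exact this.const_add u₀
  set q : ℝ → Fin 4 → ℝ := fun t => ![(α t).1.re, (α t).1.im, u₀ + k * t, 0] with hq
  set F : ℝ → ℝ := fun t => vdot A k (q t) (α t).2.re (α t).2.im with hF
  have hqd : ∀ t ∈ S, HasDerivAt q ![(α t).2.re, (α t).2.im, k, 0] t := fun t ht => by
    refine hasDerivAt_pi.2 fun a => ?_
    fin_cases a
    · exact hre (hz t ht)
    · exact him (hz t ht)
    · exact hu t
    · exact hasDerivAt_const t 0
  -- Differentiating the `v̇` prescribed by the normalization, along the transverse equations,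
  -- yields the `v`-component of the geodesic equation.
  have hFd : ∀ t ∈ S, HasDerivAt F
      (accel A (q t) ![(α t).2.re, (α t).2.im, k, F t] 3) t := fun t ht => by
    obtain ⟨D, hD, hX⟩ := hasFDerivAt_quad (p := q t)
      ((contDiffOn_reA hA).differentiableAt_of_isOpen hU (hSU t ht))
      ((contDiffOn_imA hA).differentiableAt_of_isOpen hU (hSU t ht))
    rw [← profileH_eq_quad] at hD
    have hH := hD.comp_hasDerivAt t (hqd t ht)
    have hw' := hw t ht
    rw [transverseGen_eq_accel (p := q t) (v := ![(α t).2.re, (α t).2.im, k, 0])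
      (z := (α t).1) rfl rfl rfl (α t).2] at hw'
    have h := (((((hre hw').pow 2).const_add 1).add ((him hw').pow 2)).sub
      ((hH.const_mul 2).mul_const (k ^ 2))).div_const (2 * k)
    refine HasDerivAt.congr_deriv (f := F) h ?_
    rw [hX, div_eq_iff (by simpa using hk)]
    simp [accel, ev, transv, gradH, lin, hq, reA, imA]
    ring
  have hFc : ContinuousOn F S := HasDerivAt.continuousOn hFd
  set v : ℝ → ℝ := fun t => v₀ + ∫ s in t₀..t, F s with hv
  have hvd : ∀ t ∈ S, HasDerivAt v (F t) t := fun t ht => by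
    have hsub : Set.uIcc t₀ t ⊆ S := hSc.uIcc_subset ht₀ ht
    exact (intervalIntegral.integral_hasDerivAt_right ((hFc.mono hsub).intervalIntegrable)
      (hFc.stronglyMeasurableAtFilter hS t ht) (hFc.continuousAt (hS.mem_nhds ht))).const_add v₀
  set y : ℝ → Fin 4 → ℝ := fun t => ![(α t).1.re, (α t).1.im, u₀ + k * t, v t] with hy
  set w : ℝ → Fin 4 → ℝ := fun t => ![(α t).2.re, (α t).2.im, k, F t] with hwdef
  have hHq : ∀ t, profileH A (y t) = profileH A (q t) := fun t => by
    simp [profileH_eq, hy, hq]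
  have hgq : ∀ t, gradH A (y t) = gradH A (q t) := fun t => by
    simp [gradH, lin, quad, hy, hq]
  have hyF : ∀ t, vdot A k (y t) (α t).2.re (α t).2.im = F t := fun t => by
    simp only [hF, vdot, hHq]
  refine ⟨y, isTimelikeGeodesic_of_hasDerivAt hU hA hS hSc ⟨t₀, ht₀⟩ (w := w) ?_ ?_ hSU ?_, ?_,
    fun t ht => ⟨rfl, rfl, rfl, ?_⟩⟩
  · intro t ht
    refine hasDerivAt_pi.2 fun a => ?_
    fin_cases a
    · exact hre (hz t ht)
    · exact him (hz t ht)
    · exact hu t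
    · exact hvd t ht
  · intro t ht
    have hw' := hw t ht
    rw [transverseGen_eq_accel (p := y t) (v := w t)
      (z := (α t).1) rfl rfl rfl (α t).2] at hw'
    refine hasDerivAt_pi.2 fun a => ?_
    fin_cases a
    · exact hre hw'
    · exact him hw'
    · have : accel A (y t) (w t) 2 = 0 := by simp [accel, ev, transv]
      change HasDerivAt (fun _ => k) (accel A (y t) (w t) 2) t
      rw [this]
      exact hasDerivAt_const t k
    · have : accel A (y t) (w t) 3 = accel A (q t) (w t) 3 := by simp only [accel, hgq]
      change HasDerivAt F (accel A (y t) (w t) 3) t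
      rw [this]
      exact hFd t ht
  · intro t ht
    rw [timelike_iff hk (show w t 2 = k from rfl)]
    exact (hyF t).symm
  · simp [hy, hv]
  · rw [hyF]
    exact hvd t ht

/-- A timelike geodesic can be continued past an endpoint at which `u` stays in the spacetime. -/
lemma IsTimelikeGeodesic.exists_extension (hU : IsOpen U) (hA : ContDiffOn ℝ ∞ A U)
    {T : Set ℝ} {x : ℝ → Fin 4 → ℝ} (hx : IsTimelikeGeodesic A U T x) {k u₀ : ℝ} (hk0 : k ≠ 0)
    (hk : ∀ t ∈ T, deriv x t 2 = k ∧ x t 2 = u₀ + k * t) {c : ℝ} (hc : c ∈ closure T)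
    (hcU : u₀ + k * c ∈ U) :
    ∃ T' y, T ⊆ T' ∧ c ∈ T' ∧ IsTimelikeGeodesic A U T' y ∧ Set.EqOn y x T := by
  have hDo : IsOpen {t : ℝ | u₀ + k * t ∈ U} := hU.preimage (by fun_prop)
  obtain ⟨δ, hδ, C, hID, hC, hsol⟩ :=
    exists_uniform_linear_solution hDo (continuousOn_transverseGen hA k u₀) hcU
  set I := Set.Ioo (c - δ) (c + δ)
  have hcI : c ∈ I := ⟨by linarith, by linarith⟩
  obtain ⟨t₀, ht₀I, ht₀T⟩ := mem_closure_iff_nhds.1 hc I (isOpen_Ioo.mem_nhds hcI)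
  set ξ : ℝ → ℂ × ℂ :=
    fun t => ((⟨x t 0, x t 1⟩ : ℂ), (⟨deriv x t 0, deriv x t 1⟩ : ℂ)) with hξ
  obtain ⟨α, hα0, hα⟩ := hsol t₀ ht₀I (ξ t₀)
  obtain ⟨z, hz, hz3, hzα⟩ := exists_isTimelikeGeodesic_of_transverse hU hA hk0 isOpen_Ioo
    Set.ordConnected_Ioo ht₀I hID hα (x t₀ 3)
  have hSc : (T ∩ I).OrdConnected := hx.ordConnected.inter Set.ordConnected_Ioo
  have hSo : IsOpen (T ∩ I) := hx.isOpen.inter isOpen_Ioo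
  have hξα : Set.EqOn ξ α (T ∩ I) :=
    linear_solution_unique hSc (fun t ht => hC t ht.2)
      (fun t ht => hx.hasDerivAt_transverse hU hA hk ht.1) (fun t ht => hα t ht.2)
      ⟨ht₀T, ht₀I⟩ hα0.symm
  have hp : ∀ t ∈ T ∩ I, x t 0 = z t 0 ∧ x t 1 = z t 1 ∧ x t 2 = z t 2 := fun t ht => by
    obtain ⟨h0, h1, h2, -⟩ := hzα t ht.2
    rw [h0, h1, h2, ← hξα ht]
    exact ⟨rfl, rfl, (hk t ht.1).2⟩
  have hx3 : ∀ t ∈ T ∩ I, HasDerivAt (fun t => x t 3) (deriv x t 3) t := fun t ht =>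
    hasDerivAt_pi.1 (hx.hasDerivAt ht.1) 3
  -- Both `v`-coordinates have the derivative dictated by the normalization and agree at `t₀`.
  have h3 : Set.EqOn (fun t => x t 3) (fun t => z t 3) (T ∩ I) := by
    refine hSo.eqOn_of_deriv_eq hSc.isPreconnected
      (fun t ht => (hx3 t ht).differentiableAt.differentiableWithinAt)
      (fun t ht => (hzα t ht.2).2.2.2.differentiableAt.differentiableWithinAt)
      (fun t ht => ?_) ⟨ht₀T, ht₀I⟩ hz3.symm
    rw [(hx3 t ht).deriv, (hzα t ht.2).2.2.2.deriv,
      (timelike_iff hk0 (hk t ht.1).1).1 (hx.timelike t ht.1), ← hξα ht]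
    obtain ⟨h0, h1, h2⟩ := hp t ht
    simp only [vdot, profileH_eq, h0, h1, h2, hξ]
  have heq : Set.EqOn x z (T ∩ I) := fun t ht => by
    obtain ⟨h0, h1, h2⟩ := hp t ht
    funext a
    fin_cases a
    · exact h0
    · exact h1
    · exact h2
    · exact h3 ht
  have hcon : (T ∪ I).OrdConnected :=
    (IsPreconnected.union t₀ ht₀T ht₀I hx.ordConnected.isPreconnected
      isPreconnected_Ioo).ordConnected
  obtain ⟨y, hyx, hy⟩ := hx.glue hz heq hcon
  exact ⟨T ∪ I, y, Set.subset_union_left, Or.inr hcI, hy, hyx⟩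

theorem IsInextendible.image_u_eq (hU : IsOpen U) (hUc : U.OrdConnected)
    (hA : ContDiffOn ℝ ∞ A U) {T : Set ℝ} {x : ℝ → Fin 4 → ℝ}
    (hx : IsTimelikeGeodesic A U T x) (hinx : IsInextendible A U T x) :
    (fun t => x t 2) '' T = U := by
  refine Set.Subset.antisymm (Set.image_subset_iff.2 hx.mem) fun u hu => ?_
  by_contra hnot
  obtain ⟨k, u₀, hk0, hk⟩ := hx.u_affine hU hA
  obtain ⟨t₀, ht₀⟩ := hx.nonempty
  set t₁ := (u - u₀) / k with ht₁
  have hut₁ : u₀ + k * t₁ = u := by rw [ht₁]; field_simp; ring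
  have ht₁T : t₁ ∉ T := fun h => hnot ⟨t₁, h, by simp only [(hk t₁ h).2, hut₁]⟩
  have hD : ({t : ℝ | u₀ + k * t ∈ U}).OrdConnected := by
    have hconv : Convex ℝ U := hUc.convex
    have := hconv.affine_preimage (AffineMap.lineMap u₀ (u₀ + k) : ℝ →ᵃ[ℝ] ℝ)
    have heq : (AffineMap.lineMap u₀ (u₀ + k) : ℝ →ᵃ[ℝ] ℝ) ⁻¹' U = {t : ℝ | u₀ + k * t ∈ U} := by
      ext t
      simp [AffineMap.lineMap_apply, mul_comm, add_comm]
    rw [heq] at this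
    exact this.ordConnected
  -- An endpoint of `T` on the way from `t₀` to `t₁`: without one, `T` and the complement of its
  -- closure would disconnect the segment. By convexity `u` is still in `U` at `c`, so the geodesic
  -- continues past it.
  obtain ⟨c, hcI, hcT, hcl⟩ : ∃ c ∈ Set.uIcc t₀ t₁, c ∉ T ∧ c ∈ closure T := by
    by_contra! hno
    obtain ⟨r, -, hrT, hrc⟩ := isPreconnected_uIcc T (closure T)ᶜ hx.isOpen
      isClosed_closure.isOpen_compl (fun r hr => (em (r ∈ T)).imp id (hno r hr))
      ⟨t₀, Set.left_mem_uIcc, ht₀⟩ ⟨t₁, Set.right_mem_uIcc, hno t₁ Set.right_mem_uIcc ht₁T⟩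
    exact hrc (subset_closure hrT)
  have hcU : u₀ + k * c ∈ U :=
    hD.uIcc_subset (show u₀ + k * t₀ ∈ U by rw [← (hk t₀ ht₀).2]; exact hx.mem t₀ ht₀)
      (show u₀ + k * t₁ ∈ U by rw [hut₁]; exact hu) hcI
  obtain ⟨T', y, hTT', hcT', hy, hyx⟩ :=
    hx.exists_extension hU hA hk0 hk hcl hcU
  rw [hinx T' y hTT' hy hyx] at hcT'
  exact hcT hcT'

end Extension

/-! ### From the phase of `Ψ₄` to the phase of `A`; rotations. -/

section Phase
variable {A : ℝ → ℂ} {U : Set ℝ}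

lemma psi4Along_eq (hU : IsOpen U) (hA : ContDiffOn ℝ ∞ A U) {x : ℝ → Fin 4 → ℝ} {t : ℝ}
    (ht : x t 2 ∈ U) : psi4Along A x t = ((2 * deriv x t 2 ^ 2 : ℝ) : ℂ) * A (x t 2) :=
  Psi4_interpTetrad hU hA ht _

theorem ProfilePhase.hasConstantPhase (hU : IsOpen U) (hA : ContDiffOn ℝ ∞ A U)
    (hA0 : ∀ u ∈ U, A u ≠ 0) {φ : ℝ} (hφ : ProfilePhase A U φ) : HasConstantPhase A U φ := by
  obtain ⟨s, hs, h⟩ := hφ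
  refine ⟨s, hs, fun T y hy t ht => ?_⟩
  have hu := hy.mem t ht
  have hc : 0 < 2 * deriv y t 2 ^ 2 := by
    have := hy.deriv_u_ne_zero ht
    positivity
  rw [psi4Along_eq hU hA hu, norm_mul, Complex.norm_real, Real.norm_of_nonneg hc.le]
  refine ⟨mul_ne_zero (by exact_mod_cast hc.ne') (hA0 _ hu), ?_⟩
  conv_lhs => rw [h _ hu]
  push_cast
  ring

lemma aPlus_eq (z : ℂ) : aPlus z = z.re / 2 := by
  simp [aPlus]; ring

lemma aCross_eq (z : ℂ) : aCross z = z.im / 2 := by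
  simp [aCross]; ring

lemma exp_I_mul (φ : ℝ) : Complex.exp (Complex.I * (φ : ℂ)) = ⟨Real.cos φ, Real.sin φ⟩ := by
  rw [mul_comm]
  apply Complex.ext
  · simp [Complex.exp_ofReal_mul_I_re]
  · simp [Complex.exp_ofReal_mul_I_im]

/-- The factor `2 u̇²` cancels in `A_× / A₊`, so `tan 2P = Im A / Re A` with `cos 2P > 0`. In the
other case `Re A = 0` and `e^{2iP} = ± i`. -/
lemma HasPhase.exists_real (hU : IsOpen U) (hA : ContDiffOn ℝ ∞ A U) {T : Set ℝ}
    {x : ℝ → Fin 4 → ℝ} (hx : IsTimelikeGeodesic A U T x) {P : ℝ} (hP : HasPhase A T x P) :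
    ∀ t ∈ T, ∃ r : ℝ, A (x t 2) = r * Complex.exp (Complex.I * ((2 * P : ℝ) : ℂ)) := by
  intro t ht
  have hc : 2 * deriv x t 2 ^ 2 ≠ 0 := by
    have := hx.deriv_u_ne_zero ht
    positivity
  have hψ := psi4Along_eq hU hA (hx.mem t ht)
  have hp : aPlus (psi4Along A x t) = 2 * deriv x t 2 ^ 2 * (A (x t 2)).re / 2 := by
    rw [aPlus_eq, hψ, Complex.re_ofReal_mul]
  have hm : aCross (psi4Along A x t) = 2 * deriv x t 2 ^ 2 * (A (x t 2)).im / 2 := by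
    rw [aCross_eq, hψ, Complex.im_ofReal_mul]
  rw [exp_I_mul]
  rcases hP with hP | ⟨h0, hP⟩
  · obtain ⟨hne, hPt⟩ := hP t ht
    rw [hp] at hne
    have hre : (A (x t 2)).re ≠ 0 := fun h => hne (by rw [h]; ring)
    have h2P : 2 * P = Real.arctan ((A (x t 2)).im / (A (x t 2)).re) := by
      rw [hPt, hp, hm]
      rw [div_div_div_cancel_right₀ (two_ne_zero), mul_div_mul_left _ _ hc]
      ring
    have hcos : Real.cos (2 * P) ≠ 0 := by rw [h2P]; exact (Real.cos_arctan_pos _).ne'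
    have htan : Real.sin (2 * P) / Real.cos (2 * P) = (A (x t 2)).im / (A (x t 2)).re := by
      rw [← Real.tan_eq_sin_div_cos, h2P, Real.tan_arctan]
    rw [div_eq_div_iff hcos hre] at htan
    refine ⟨(A (x t 2)).re / Real.cos (2 * P), Complex.ext ?_ ?_⟩
    · rw [Complex.re_ofReal_mul]
      field_simp
    · rw [Complex.im_ofReal_mul, div_mul_eq_mul_div, eq_div_iff hcos]
      linarith
  · have hre : (A (x t 2)).re = 0 := by
      have := h0 t ht
      rw [hp] at this
      simpa [hx.deriv_u_ne_zero ht] using this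
    rcases hP with rfl | rfl
    · refine ⟨(A (x t 2)).im, Complex.ext ?_ ?_⟩
      · rw [Complex.re_ofReal_mul, hre, show 2 * (Real.pi / 4) = Real.pi / 2 by ring]
        simp
      · rw [Complex.im_ofReal_mul, show 2 * (Real.pi / 4) = Real.pi / 2 by ring]
        simp
    · refine ⟨-(A (x t 2)).im, Complex.ext ?_ ?_⟩
      · rw [Complex.re_ofReal_mul, hre, show 2 * -(Real.pi / 4) = -(Real.pi / 2) by ring]
        simp
      · rw [Complex.im_ofReal_mul, show 2 * -(Real.pi / 4) = -(Real.pi / 2) by ring]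
        simp

/-- The real factor is continuous and has no zero, so it keeps one sign on the connected set `U`. -/
lemma profilePhase_of_exists_real (hU : IsPreconnected U) (hA : ContinuousOn A U)
    (hA0 : ∀ u ∈ U, A u ≠ 0) {φ : ℝ}
    (h : ∀ u ∈ U, ∃ r : ℝ, A u = r * Complex.exp (Complex.I * (φ : ℂ))) :
    ProfilePhase A U φ := by
  -- An explicit formula for the real factor, from which its continuity is visible.
  set r : ℝ → ℝ := fun u => (A u * Complex.exp (-(Complex.I * (φ : ℂ)))).re with hr
  have hrA : ∀ u ∈ U, A u = r u * Complex.exp (Complex.I * (φ : ℂ)) := by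
    intro u hu
    obtain ⟨ρ, hρ⟩ := h u hu
    have : r u = ρ := by
      simp only [hr]
      rw [hρ, mul_assoc, ← Complex.exp_add, add_neg_cancel, Complex.exp_zero, mul_one,
        Complex.ofReal_re]
    rw [this]; exact hρ
  have hr0 : ∀ u ∈ U, r u ≠ 0 := fun u hu h0 => hA0 u hu (by rw [hrA u hu, h0]; simp)
  have hrc : ContinuousOn r U :=
    Complex.continuous_re.comp_continuousOn (hA.mul continuousOn_const)
  have hnorm : ∀ u ∈ U, ‖A u‖ = |r u| := fun u hu => by
    conv_lhs => rw [hrA u hu]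
    rw [norm_mul, mul_comm Complex.I, Complex.norm_exp_ofReal_mul_I, Complex.norm_real, mul_one,
      Real.norm_eq_abs]
  have hsign : (∀ u ∈ U, 0 < r u) ∨ ∀ u ∈ U, r u < 0 := by
    by_contra! hno
    obtain ⟨⟨u, hu, hru⟩, u', hu', hru'⟩ := hno
    obtain ⟨w, hw, hw0⟩ := (hU.image r hrc).ordConnected.out ⟨u, hu, rfl⟩ ⟨u', hu', rfl⟩
      ⟨hru, hru'⟩
    exact hr0 w hw hw0
  rcases hsign with hpos | hneg
  · refine ⟨1, Or.inl rfl, fun u hu => ?_⟩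
    rw [hnorm u hu, abs_of_pos (hpos u hu), Complex.ofReal_one, one_mul]
    exact hrA u hu
  · refine ⟨-1, Or.inr rfl, fun u hu => ?_⟩
    rw [hnorm u hu, abs_of_neg (hneg u hu), ← Complex.ofReal_mul, neg_one_mul, neg_neg]
    exact hrA u hu

/-- The profile of the plane wave rotated by `θ`. -/
def rotProfile (θ : ℝ) (A : ℝ → ℂ) (u : ℝ) : ℂ :=
  A u * Complex.exp (Complex.I * ((-(2 * θ) : ℝ) : ℂ))

/-- The factor `e^{-2iθ}` compensates for `ζ² ↦ e^{2iθ} ζ²`, so `H` is preserved. -/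
lemma rotationEquivalent_rotProfile (θ : ℝ) (A : ℝ → ℂ) (U : Set ℝ) :
    RotationEquivalent θ A (rotProfile θ A) U := by
  intro p _ X Y
  have hz : zeta (rot θ p) = Complex.exp (Complex.I * (θ : ℂ)) * zeta p := by
    have : Complex.exp (Complex.I * (θ : ℂ)) = Real.cos θ + Real.sin θ * Complex.I := by
      rw [mul_comm, Complex.exp_mul_I]; push_cast; rfl
    rw [this]
    simp only [zeta, rot, Matrix.cons_val, Complex.ofReal_sub, Complex.ofReal_add,
      Complex.ofReal_mul]
    linear_combination (-(Real.sin θ : ℂ) * p 1 / ((√2 : ℝ) : ℂ)) * Complex.I_sq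
  have hH : profileH (rotProfile θ A) (rot θ p) = profileH A p := by
    unfold profileH
    rw [hz, show rot θ p 2 = p 2 from rfl, rotProfile, mul_pow, ← Complex.exp_nat_mul, mul_assoc,
      ← mul_assoc (Complex.exp _) (Complex.exp _), ← Complex.exp_add]
    rw [show Complex.I * ((-(2 * θ) : ℝ) : ℂ) + ((2 : ℕ) : ℂ) * (Complex.I * (θ : ℂ)) = 0 by
      push_cast; ring, Complex.exp_zero, one_mul]
  rw [sum_metric, sum_metric, hH]
  simp only [rot, Matrix.cons_val]
  linear_combination (X 0 * Y 0 + X 1 * Y 1) * Real.sin_sq_add_cos_sq θ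

lemma norm_rotProfile (θ : ℝ) (A : ℝ → ℂ) (u : ℝ) : ‖rotProfile θ A u‖ = ‖A u‖ := by
  rw [rotProfile, norm_mul, mul_comm Complex.I, Complex.norm_exp_ofReal_mul_I, mul_one]

lemma rotProfile_ne_zero {θ u : ℝ} (h : A u ≠ 0) : rotProfile θ A u ≠ 0 := by
  rwa [← norm_ne_zero_iff, norm_rotProfile, norm_ne_zero_iff]

lemma contDiffOn_rotProfile (θ : ℝ) (hA : ContDiffOn ℝ ∞ A U) :
    ContDiffOn ℝ ∞ (rotProfile θ A) U :=
  hA.mul contDiffOn_const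

lemma ProfilePhase.rotProfile {φ : ℝ} (h : ProfilePhase A U φ) (θ : ℝ) :
    ProfilePhase (rotProfile θ A) U (φ - 2 * θ) := by
  obtain ⟨s, hs, h⟩ := h
  refine ⟨s, hs, fun u hu => ?_⟩
  rw [norm_rotProfile, PlaneWave.rotProfile]
  conv_lhs => rw [h u hu]
  rw [mul_assoc, ← Complex.exp_add]
  congr 2
  push_cast
  ring

lemma ProfilePhase.im_eq_zero {φ : ℝ} (h : ProfilePhase A U φ) (hφ : Real.sin φ = 0) :
    ∀ u ∈ U, (A u).im = 0 := by
  obtain ⟨s, -, h⟩ := h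
  intro u hu
  rw [h u hu, ← Complex.ofReal_mul, exp_I_mul, Complex.im_ofReal_mul, hφ, mul_zero]

lemma ProfilePhase.re_eq_zero {φ : ℝ} (h : ProfilePhase A U φ) (hφ : Real.cos φ = 0) :
    ∀ u ∈ U, (A u).re = 0 := by
  obtain ⟨s, -, h⟩ := h
  intro u hu
  rw [h u hu, ← Complex.ofReal_mul, exp_I_mul, Complex.re_ofReal_mul, hφ, mul_zero]

/-- Multiplication by `-i` exchanges real and imaginary parts up to sign, so the exchange of modes
is read off from `A` without knowing `P`. -/
lemma rotProfile_pi_div_four (u : ℝ) :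
    PlaneWave.rotProfile (Real.pi / 4) A u = ⟨(A u).im, -(A u).re⟩ := by
  rw [PlaneWave.rotProfile, exp_I_mul, show -(2 * (Real.pi / 4)) = -(Real.pi / 2) by ring]
  apply Complex.ext <;> simp

end Phase

end PlaneWave

end

/-! ### The main theorem. -/

open PlaneWave in
theorem lemma2 (A : ℝ → ℂ) (J : Set ℝ) (hJo : IsOpen J) (hJc : J.OrdConnected)
    (hA : ContDiffOn ℝ ((⊤ : ℕ∞) : WithTop ℕ∞) A J) (hA0 : ∀ u ∈ J, A u ≠ 0)
    (T : Set ℝ) (x : ℝ → Fin 4 → ℝ) (hx : PlaneWave.IsTimelikeGeodesic A J T x)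
    (P : ℝ) (hP : PlaneWave.HasPhase A T x P)
    (U : Set ℝ) (hU : U = (fun τ => x τ 2) '' T) :
    -- linear polarization on the part of the spacetime swept out by the wavefronts that `x` crosses,
    -- which is all of it if `x` is inextendible
    PlaneWave.IsLinearlyPolarized A U ∧
    PlaneWave.HasConstantPhase A U (2 * P) ∧
    (PlaneWave.IsInextendible A J T x → U = J) ∧
    -- the two modes
    (P = 0 → PlaneWave.IsPlusPolarized A U) ∧
    (P = Real.pi / 4 ∨ P = -(Real.pi / 4) → PlaneWave.IsCrossPolarized A U) ∧
    -- rotations change the phase at will, carry the wave to either mode, and exchange the modes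
    (∀ θ : ℝ, ∃ B : ℝ → ℂ, PlaneWave.RotationEquivalent θ A B U ∧
      PlaneWave.IsLinearlyPolarized B U ∧ PlaneWave.HasConstantPhase B U (2 * (P - θ))) ∧
    (∃ B : ℝ → ℂ, PlaneWave.RotationEquivalent P A B U ∧ PlaneWave.IsPlusPolarized B U) ∧
    (∃ B : ℝ → ℂ, PlaneWave.RotationEquivalent (P + Real.pi / 4) A B U ∧
      PlaneWave.IsCrossPolarized B U) ∧
    (PlaneWave.IsPlusPolarized A U → ∃ B : ℝ → ℂ,
      PlaneWave.RotationEquivalent (Real.pi / 4) A B U ∧ PlaneWave.IsCrossPolarized B U) ∧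
    (PlaneWave.IsCrossPolarized A U → ∃ B : ℝ → ℂ,
      PlaneWave.RotationEquivalent (Real.pi / 4) A B U ∧ PlaneWave.IsPlusPolarized B U) := by
  obtain ⟨k, u₀, hk0, hk⟩ := hx.u_affine hJo hA
  have hUJ : U ⊆ J := by
    rw [hU]; exact Set.image_subset_iff.2 hx.mem
  have hUo : IsOpen U := by
    -- Since `u` is affine with slope `k ≠ 0`, the image of `T` is a preimage under the inverse map,
    -- hence open.
    have hUe : U = (fun u => (u - u₀) / k) ⁻¹' T := by
      rw [hU]
      ext u
      constructor
      · rintro ⟨t, ht, rfl⟩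
        have : (x t 2 - u₀) / k = t := by rw [(hk t ht).2]; field_simp; ring
        simpa only [Set.mem_preimage, this] using ht
      · intro hu
        refine ⟨(u - u₀) / k, hu, ?_⟩
        simp only [(hk _ hu).2]
        field_simp
        ring
    rw [hUe]
    exact hx.isOpen.preimage (by fun_prop)
  have hUc : IsPreconnected U := by
    rw [hU]
    exact hx.ordConnected.isPreconnected.image _
      ((continuous_apply 2).comp_continuousOn hx.contDiffOn.continuousOn)
  have hAU : ContDiffOn ℝ ((⊤ : ℕ∞) : WithTop ℕ∞) A U := hA.mono hUJ
  have hA0U : ∀ u ∈ U, A u ≠ 0 := fun u hu => hA0 u (hUJ hu)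
  have hph : ProfilePhase A U (2 * P) := by
    refine profilePhase_of_exists_real hUc hAU.continuousOn hA0U fun u hu => ?_
    rw [hU] at hu
    obtain ⟨t, ht, rfl⟩ := hu
    exact hP.exists_real hJo hA hx t ht
  have hlin : IsLinearlyPolarized A U := isLinearlyPolarized hUo hAU hA0U hph
  have hB : ∀ θ, IsLinearlyPolarized (rotProfile θ A) U := fun θ =>
    isLinearlyPolarized hUo (contDiffOn_rotProfile θ hAU)
      (fun u hu => rotProfile_ne_zero (hA0U u hu)) (hph.rotProfile θ)
  refine ⟨hlin, hph.hasConstantPhase hUo hAU hA0U, fun hin => ?_, fun h => ⟨hlin, ?_⟩,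
    fun h => ⟨hlin, ?_⟩, fun θ => ⟨rotProfile θ A, rotationEquivalent_rotProfile θ A U, hB θ, ?_⟩,
    ⟨rotProfile P A, rotationEquivalent_rotProfile _ A U, hB _, ?_⟩,
    ⟨rotProfile (P + Real.pi / 4) A, rotationEquivalent_rotProfile _ A U, hB _, ?_⟩,
    fun h => ⟨rotProfile (Real.pi / 4) A, rotationEquivalent_rotProfile _ A U, hB _, ?_⟩,
    fun h => ⟨rotProfile (Real.pi / 4) A, rotationEquivalent_rotProfile _ A U, hB _, ?_⟩⟩
  · rw [hU]; exact hin.image_u_eq hJo hJc hA hx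
  · exact hph.im_eq_zero (by rw [h]; simp)
  · refine hph.re_eq_zero ?_
    rcases h with rfl | rfl
    · rw [show 2 * (Real.pi / 4) = Real.pi / 2 by ring, Real.cos_pi_div_two]
    · rw [show 2 * -(Real.pi / 4) = -(Real.pi / 2) by ring, Real.cos_neg, Real.cos_pi_div_two]
  · rw [mul_sub]
    exact (hph.rotProfile θ).hasConstantPhase hUo (contDiffOn_rotProfile θ hAU)
      fun u hu => rotProfile_ne_zero (hA0U u hu)
  · exact (hph.rotProfile P).im_eq_zero (by simp)
  · refine (hph.rotProfile (P + Real.pi / 4)).re_eq_zero ?_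
    rw [show 2 * P - 2 * (P + Real.pi / 4) = -(Real.pi / 2) by ring, Real.cos_neg,
      Real.cos_pi_div_two]
  · intro u hu
    rw [rotProfile_pi_div_four]; exact h.2 u hu
  · intro u hu
    rw [rotProfile_pi_div_four]; simp [h.2 u hu]
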